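/- Let $d\ge 2$ and let $M=\mathbb R_r\times\mathbb S^{d-1}_\theta$ carry the metric $g=dr^2+\alpha(r)^2g_0$, where $g_0$ is the round metric on the unit sphere and $\alpha\in C^\infty(\mathbb R;(0,\infty))$ satisfies $\alpha(r)=1$ for $|r|\le 2$, $\alpha(r)=|r|$ for $|r|\ge 4$, and $r\alpha'(r)>0$ for $|r|>2$. Let $p(x,\xi)=|\xi|_{g(x)}$, let $\varphi_t=\exp(tH_p)$ be the homogeneous geodesic flow on $T^*M\setminus 0$, let $\rho$ be the momentum dual to $r$, let $S^*M=\{p=1\}$, and let $\mu_L$ be the Liouville measure on $S^*M$. Let $K$ be the trapped set, that is, the set of all $\mathbf x\in T^*M\setminus 0$ such that $|r(\varphi_t(\mathbf x))|\not\to\infty$ as $t\to+\infty$ and also $|r(\varphi_t(\mathbf x))|\not\to\infty$ as $t\to-\infty$. Put $\mathcal B=\{|r|\le 3\}\subset M$, let $\pi:T^*M\setminus 0\to M$ be the projection, and define the trapped volume $$\mathcal V(t)=\mu_L\big(S^*M\cap\pi^{-1}(\mathcal B)\cap\varphi_{-t}(\pi^{-1}(\mathcal B))\big).$$ Then: 1.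 $K=\{|r|\le 2,\ \rho=0\}\subset T^*M\setminus 0$. 2. There is a constant $C>0$ such that $C^{-1}t^{-1}\le\mathcal V(t)\le Ct^{-1}$ for all $t\ge 1$. 3. For all $\Lambda>0$, $\beta\ge 0$ and $0<\varepsilon<1$ there is a constant $C>0$ such that, with $t_e(R)=\frac{\log R}{2\Lambda}$, $$R^{d-1}\min\Big[\mathcal V\big((1-\varepsilon)t_e(R)\big),\ e^{2\beta t_e(R)}\,\mathcal V\big(2(1-\varepsilon)t_e(R)\big)\Big]\ \le\ C\,\frac{R^{d-1}}{\log R}\qquad\text{for all }R\ge 2.$$ (For suitable $\Lambda$, the left-hand side is, up to a constant factor, the general Weyl upper bound for the number of scattering resonances in $[R,R+1]+i[-\beta,0]$; thus that bound improves on $\mathcal O(R^{d-1})$ by a power of $\log R$.) -/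

import Mathlib

open Set Filter Topology MeasureTheory
open scoped RealInnerProductSpace ENNReal ContDiff

noncomputable section

namespace Revolution

/-- Euclidean space `ℝ^d`, whose unit sphere is `S^{d-1}`. -/
abbrev E (d : ℕ) : Type := EuclideanSpace ℝ (Fin d)

/-- The ambient space `ℝ × ℝ^d` of `M = ℝ × S^{d-1}`; its points are `(r, θ)`. -/
abbrev Pos (d : ℕ) : Type := ℝ × E d

/-- The ambient space of `T^*M`. A point is `((r, θ), (ρ, η))`, where `ρ` and `η` are the momenta
dual to `r` and `θ`. -/
abbrev Phase (d : ℕ) : Type := Pos d × Pos d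

/-- The manifold `M = ℝ × S^{d-1}`. -/
def mfd (d : ℕ) : Set (Pos d) := {x | ‖x.2‖ = 1}

/-- The tangent space to `M` at `x = (r, θ)`: pairs `(a, v)` with `v ⟂ θ`. The same set is used as
the cotangent space, a covector `(ρ, η)` acting by `(a, v) ↦ ρ a + ⟪η, v⟫`. -/
def tangentM {d : ℕ} (x : Pos d) : Set (Pos d) := {v | ⟪x.2, v.2⟫ = 0}

/-- The metric `g = dr² + α(r)² g₀` as a quadratic form, `g₀` being the round metric, that is, the
restriction of the Euclidean inner product of `ℝ^d`. -/
def metric {d : ℕ} (α : ℝ → ℝ) (x v : Pos d) : ℝ := v.1 ^ 2 + α x.1 ^ 2 * ‖v.2‖ ^ 2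

/-- The cotangent bundle without its zero section, `T^*M \ 0`. -/
def cotangent (d : ℕ) : Set (Phase d) := {x | x.1 ∈ mfd d ∧ x.2 ∈ tangentM x.1 ∧ x.2 ≠ 0}

/-- The length `p(x, ξ) = |ξ|_{g(x)}` of a covector, `p² = ρ² + α(r)⁻² |η|²`. -/
def symbol {d : ℕ} (α : ℝ → ℝ) (x : Phase d) : ℝ :=
  Real.sqrt (x.2.1 ^ 2 + (α x.1.1)⁻¹ ^ 2 * ‖x.2.2‖ ^ 2)

/-- `symbol` is the norm dual to the metric: it is the maximum of `ξ` on the unit tangent ball. -/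
theorem symbol_isGreatest {d : ℕ} (α : ℝ → ℝ) (x : Phase d) (hα : 0 < α x.1.1)
    (hx : x ∈ cotangent d) :
    IsGreatest {s : ℝ | ∃ v ∈ tangentM x.1, metric α x.1 v ≤ 1 ∧ s = x.2.1 * v.1 + ⟪x.2.2, v.2⟫}
      (symbol α x) := by
  obtain ⟨⟨r, θ⟩, ⟨ρ, η⟩⟩ := x
  obtain ⟨-, hη, hne⟩ := hx
  simp only [tangentM, mem_ofPred_eq] at hη
  simp only [symbol, metric, tangentM, mem_ofPred_eq] at *
  set A := α r
  have hq : 0 < ρ ^ 2 + A⁻¹ ^ 2 * ‖η‖ ^ 2 := by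
    by_contra hcon
    have h1 : 0 ≤ A⁻¹ ^ 2 * ‖η‖ ^ 2 := by positivity
    have h2 : ρ = 0 := by nlinarith [sq_nonneg ρ]
    have h3 : A⁻¹ ^ 2 * ‖η‖ ^ 2 = 0 := by nlinarith [sq_nonneg ρ]
    have h4 : η = 0 := by
      have : A⁻¹ ^ 2 ≠ 0 := by positivity
      simpa [this, hα.ne'] using h3
    exact hne (by rw [h2, h4]; rfl)
  set q := ρ ^ 2 + A⁻¹ ^ 2 * ‖η‖ ^ 2 with hqd
  have hs : 0 < Real.sqrt q := Real.sqrt_pos.2 hq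
  have hs2 : Real.sqrt q ^ 2 = q := Real.sq_sqrt hq.le
  refine ⟨⟨(ρ / Real.sqrt q, (A⁻¹ ^ 2 / Real.sqrt q) • η), ?_, ?_, ?_⟩, ?_⟩
  · simp [inner_smul_right, hη]
  · rw [norm_smul, Real.norm_of_nonneg (by positivity)]
    apply le_of_eq
    have : (ρ / Real.sqrt q) ^ 2 + A ^ 2 * (A⁻¹ ^ 2 / Real.sqrt q * ‖η‖) ^ 2
        = q / Real.sqrt q ^ 2 := by
      rw [hqd]; field_simp
    rw [this, hs2, div_self hq.ne']
  · rw [inner_smul_right, real_inner_self_eq_norm_sq]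
    have : ρ * (ρ / Real.sqrt q) + A⁻¹ ^ 2 / Real.sqrt q * ‖η‖ ^ 2 = q / Real.sqrt q := by
      rw [hqd]; ring
    rw [this, Real.div_sqrt]
  · rintro s ⟨v, -, hv, rfl⟩
    apply Real.le_sqrt_of_sq_le
    have hcs : ⟪η, v.2⟫ ≤ ‖η‖ * ‖v.2‖ := real_inner_le_norm _ _
    have hcs' : -(‖η‖ * ‖v.2‖) ≤ ⟪η, v.2⟫ := neg_le_of_abs_le (abs_real_inner_le_norm _ _)
    have e : ‖η‖ * ‖v.2‖ = (A⁻¹ * ‖η‖) * (A * ‖v.2‖) := by field_simp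
    have habs : |ρ * v.1 + ⟪η, v.2⟫| ≤ |ρ| * |v.1| + (A⁻¹ * ‖η‖) * (A * ‖v.2‖) := by
      rw [← e, ← abs_mul]
      exact (abs_add_le _ _).trans (by gcongr; exact abs_real_inner_le_norm _ _)
    have h5 : (ρ * v.1 + ⟪η, v.2⟫) ^ 2 ≤ (|ρ| * |v.1| + (A⁻¹ * ‖η‖) * (A * ‖v.2‖)) ^ 2 :=
      sq_le_sq' (by linarith [neg_abs_le (ρ * v.1 + ⟪η, v.2⟫)]) ((le_abs_self _).trans habs)
    have h6 : (|ρ| * |v.1| + (A⁻¹ * ‖η‖) * (A * ‖v.2‖)) ^ 2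
        ≤ (|ρ| ^ 2 + (A⁻¹ * ‖η‖) ^ 2) * (|v.1| ^ 2 + (A * ‖v.2‖) ^ 2) := by
      nlinarith [sq_nonneg (|ρ| * (A * ‖v.2‖) - (A⁻¹ * ‖η‖) * |v.1|)]
    have h7 : |ρ| ^ 2 + (A⁻¹ * ‖η‖) ^ 2 = q := by rw [hqd, sq_abs]; ring
    have h8 : |v.1| ^ 2 + (A * ‖v.2‖) ^ 2 ≤ 1 := by rw [sq_abs]; linarith
    rw [h7] at h6
    nlinarith

/-- The tangent space to `T^*M` at `x`: the linearization of `|θ|² = 1`, `⟪θ, η⟫ = 0`. -/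
def tangentT {d : ℕ} (x : Phase d) : Set (Phase d) :=
  {u | ⟪x.1.2, u.1.2⟫ = 0 ∧ ⟪u.1.2, x.2.2⟫ + ⟪x.1.2, u.2.2⟫ = 0}

/-- The canonical symplectic form `dρ ∧ dr + ∑ dη_j ∧ dθ_j`, to be restricted to `T^*M`. -/
def symplectic {d : ℕ} (u w : Phase d) : ℝ :=
  (u.2.1 * w.1.1 + ⟪u.2.2, w.1.2⟫) - (u.1.1 * w.2.1 + ⟪u.1.2, w.2.2⟫)

/-- `γ` is a complete integral curve in `T^*M \ 0` of the Hamiltonian vector field `H_p` of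
`p = |ξ|_g`, the latter being characterized by `ω(u, H_p) = dp(u)` for all tangent vectors `u`. -/
def IsHamiltonCurve {d : ℕ} (α : ℝ → ℝ) (γ : ℝ → Phase d) : Prop :=
  (∀ t, γ t ∈ cotangent d) ∧
    ∀ t, ∃ H : Phase d, HasDerivAt γ H t ∧
      ∀ u ∈ tangentT (γ t), symplectic u H = fderiv ℝ (symbol α) (γ t) u

open Classical in
/-- The homogeneous geodesic flow `φ_t = exp(t H_p)` on `T^*M \ 0`. -/
def flow {d : ℕ} (α : ℝ → ℝ) (t : ℝ) (x : Phase d) : Phase d :=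
  if h : ∃ γ : ℝ → Phase d, IsHamiltonCurve α γ ∧ γ 0 = x then h.choose t else x

/-- The outgoing tail `Γ₊`: `|r(φ_t(x))|` does not tend to infinity as `t → -∞`. -/
def tailPlus (d : ℕ) (α : ℝ → ℝ) : Set (Phase d) :=
  {x | x ∈ cotangent d ∧ ¬ Tendsto (fun t => |(flow α t x).1.1|) atBot atTop}

/-- The incoming tail `Γ₋`: `|r(φ_t(x))|` does not tend to infinity as `t → +∞`. -/
def tailMinus (d : ℕ) (α : ℝ → ℝ) : Set (Phase d) :=
  {x | x ∈ cotangent d ∧ ¬ Tendsto (fun t => |(flow α t x).1.1|) atTop atTop}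

/-- The trapped set `K = Γ₊ ∩ Γ₋`. -/
def trappedSet (d : ℕ) (α : ℝ → ℝ) : Set (Phase d) := tailPlus d α ∩ tailMinus d α

/-- The cosphere bundle `S^*M = {p = 1}`. -/
def cosphere (d : ℕ) (α : ℝ → ℝ) : Set (Phase d) := {x | x ∈ cotangent d ∧ symbol α x = 1}

/-- The symplectic volume `dx dξ` on `T^*M`: `dr dρ` times the volume of `T^*S^{d-1}`, which is the
surface measure on the sphere and Lebesgue measure on each cotangent space `θ^⟂`. -/
def symplecticVolume {d : ℕ} (A : Set (Phase d)) : ℝ≥0∞ :=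
  ∫⁻ r : ℝ, ∫⁻ θ : Metric.sphere (0 : E d) 1, ∫⁻ ρ : ℝ,
    (volume : Measure (ℝ ∙ (θ : E d))ᗮ) {η | ((r, (θ : E d)), (ρ, (η : E d))) ∈ A}
    ∂volume ∂(volume : Measure (E d)).toSphere ∂volume

/-- The Liouville measure `μ_L` of a subset of `S^*M`, normalized by `dx dξ = p^{d-1} dp dμ_L`:
`d` times the symplectic volume of the cone `{0 < p ≤ 1}` over the set. -/
def liouville {d : ℕ} (α : ℝ → ℝ) (A : Set (Phase d)) : ℝ≥0∞ :=
  d * symplecticVolume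
    {x : Phase d | x ∈ cotangent d ∧ symbol α x ≤ 1 ∧ (x.1, (symbol α x)⁻¹ • x.2) ∈ A}

/-- `𝒯(t) = π⁻¹(B) ∩ φ_{-t}(π⁻¹(B))`: the trajectories which are in `B` at the times `0`
and `t`. -/
def trappedFor {d : ℕ} (α : ℝ → ℝ) (B : Set (Pos d)) (t : ℝ) : Set (Phase d) :=
  {x | x ∈ cotangent d ∧ x.1 ∈ B ∧ (flow α t x).1 ∈ B}

/-- The compact region `{|r| ≤ 3}` of `M`. -/
def region (d : ℕ) : Set (Pos d) := {x | x ∈ mfd d ∧ |x.1| ≤ 3}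

/-- The trapped volume `𝒱(t) = μ_L(S^*M ∩ 𝒯(t))` for the region `{|r| ≤ 3}`. -/
def trappedVolume (d : ℕ) (α : ℝ → ℝ) (t : ℝ) : ℝ≥0∞ :=
  liouville α (cosphere d α ∩ trappedFor α (region d) t)

/-- The profiles with a cylindrical part: `α = 1` for `|r| ≤ 2`, `α = |r|` for `|r| ≥ 4`, and
`r α' > 0` for `|r| > 2`. -/
structure IsCylindricalProfile (α : ℝ → ℝ) : Prop where
  smooth : ContDiff ℝ ∞ α
  pos : ∀ r, 0 < α r
  eq_one : ∀ r, |r| ≤ 2 → α r = 1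
  eq_abs : ∀ r, 4 ≤ |r| → α r = |r|
  mul_deriv_pos : ∀ r, 2 < |r| → 0 < r * deriv α r

end Revolution

end

noncomputable section

/-! ### Profiles and the radial equation of motion -/

namespace Revolution

open scoped Manifold NNReal

/-! Rotational symmetry reduces everything to one dimension. At unit speed and squared angular
momentum `c`, the radial position and velocity satisfy `r' = v`, `v' = c α'/α³` and `v² + c/α² = 1`
(`IsHamiltonCurve.isTrajectory`). Since `r α' ≥ 0`, the derivative `v² + c r α'/α³` of `r v` is
nonnegative, so `r²` is convex. It is positive unless the trajectory rests in the cylinder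
(`strictMono_mul`). Hence every other trajectory escapes in at least one time direction, which gives
the trapped set.

For the lower bound, covectors over `|r| ≤ 1` with `|ρ| ≤ 1/(4t)` and `‖η‖` of order one move in a
straight line and are still in the cylinder at time `t`; they fill a volume of order `1/t`.

For the upper bound, convexity keeps a trajectory that is in `|r| ≤ 3` at times `0` and `t` there in
between, and `r` is injective on one half of that interval. So `t/2` is at most the integral of `(1
- c/α(y)²)^(-1/2)` over `|y| ≤ 3` (`half_le_transitTime`). In terms of the slope `u = ρ/‖η‖`, `c =
1/(u² + b)` with `b = α(r 0)⁻²`. Instead of studying the transit time for each `u`, which would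
depend on how flat `α` is near `|r| = 2`, one averages it over `u`. For each `y` the integrand has
at worst an inverse square root singularity in `u`, with explicit constants once `u > 1/t`. Tonelli
and Markov then bound the slopes with transit time at least `t/2` by a set of measure `O(1/t)`
(`volume_slowSlopes_le`), and the slopes with `|u| ≤ 1/t` cost as much again. Integrating over `r`,
`θ`, `η` finishes the bound, and the resonance estimate follows by inserting a time proportional to
`log R`. -/

/-- A globally Lipschitz `C¹` vector field is complete. -/
theorem exists_integralCurve_of_lipschitz {F : Type*} [NormedAddCommGroup F] [NormedSpace ℝ F]
    [CompleteSpace F] {V : F → F} (hV : ContDiff ℝ 1 V) {K : ℝ≥0} (hK : LipschitzWith K V) (x : F) :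
    ∃ γ : ℝ → F, γ 0 = x ∧ ∀ t, HasDerivAt γ (V (γ t)) t := by
  have hε : (0 : ℝ) < (1 + K : ℝ)⁻¹ := by positivity
  have key : ∃ γ : ℝ → F, γ 0 = x ∧ IsMIntegralCurve (I := 𝓘(ℝ, F)) γ V := by
    refine exists_isMIntegralCurve_of_isMIntegralCurveOn (I := 𝓘(ℝ, F)) (v := V) ?_ hε ?_ x
    · exact contMDiff_vectorSpace_iff_contDiff.2 hV
    · intro y
      -- On the ball of radius `‖V y‖ + 1` about `y` the speed is at most `(1 + K)(‖V y‖ + 1)`, so a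
      -- solution lasts for the time `1/(1 + K)`, which does not depend on `y`.
      have hpl : IsPicardLindelof (fun _ : ℝ => V) (tmin := -(1 + K : ℝ)⁻¹) (tmax := (1 + K : ℝ)⁻¹)
          ⟨0, by constructor <;> linarith⟩ y (‖V y‖₊ + 1) 0 ((1 + K) * (‖V y‖₊ + 1)) K := by
        refine ⟨fun _ _ => hK.lipschitzOnWith, fun _ _ => continuousOn_const, ?_, ?_⟩
        · intro _ _ z hz
          have h1 : ‖V z - V y‖ ≤ K * ‖z - y‖ := by
            simpa [dist_eq_norm] using hK.dist_le_mul z y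
          have h2 : ‖z - y‖ ≤ ‖V y‖ + 1 := by
            simpa [dist_eq_norm] using hz
          have h3 : ‖V z‖ ≤ ‖V y‖ + ‖V z - V y‖ := by
            simpa using norm_add_le (V y) (V z - V y)
          have h4 : (K : ℝ) * ‖z - y‖ ≤ K * (‖V y‖ + 1) := by gcongr
          push_cast
          nlinarith
        · push_cast
          simp only [sub_zero, zero_sub, neg_neg, max_self]
          rw [mul_right_comm, mul_inv_cancel₀ (by positivity), one_mul]
      obtain ⟨γ, h0, hγ⟩ := hpl.exists_eq_forall_mem_Icc_hasDerivWithinAt₀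
      refine ⟨γ, h0, fun t ht => ?_⟩
      have h1 : HasDerivWithinAt γ (V (γ t)) (Ioo (-(1 + K : ℝ)⁻¹) (1 + K : ℝ)⁻¹) t :=
        (hγ t (Ioo_subset_Icc_self ht)).mono Ioo_subset_Icc_self
      have h2 := h1.hasFDerivWithinAt
      exact HasFDerivWithinAt.hasMFDerivWithinAt h2
  obtain ⟨γ, h0, hγ⟩ := key
  refine ⟨γ, h0, fun t => ?_⟩
  have h1 : HasFDerivAt γ ((1 : ℝ →L[ℝ] ℝ).smulRight (V (γ t)) : ℝ →L[ℝ] F) t :=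
    HasMFDerivAt.hasFDerivAt (hγ t)
  simpa using h1.hasDerivAt

/-- The radial acceleration `α'/α³` of a geodesic of unit speed and unit angular momentum. -/
def force (α : ℝ → ℝ) (r : ℝ) : ℝ := deriv α r / α r ^ 3


theorem IsCylindricalProfile.differentiable {α : ℝ → ℝ} (hα : IsCylindricalProfile α) :
    Differentiable ℝ α := hα.smooth.differentiable (by simp)

theorem IsCylindricalProfile.continuous_deriv {α : ℝ → ℝ} (hα : IsCylindricalProfile α) :
    Continuous (deriv α) := hα.smooth.continuous_deriv (by simp)

theorem IsCylindricalProfile.deriv_eq_zero {α : ℝ → ℝ} (hα : IsCylindricalProfile α) {r : ℝ}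
    (hr : |r| ≤ 2) : deriv α r = 0 := by
  have hcl : IsClosed {r | deriv α r = 0} := isClosed_eq hα.continuous_deriv continuous_const
  have hsub : Ioo (-2 : ℝ) 2 ⊆ {r | deriv α r = 0} := by
    intro s hs
    have : α =ᶠ[𝓝 s] fun _ => 1 := by
      filter_upwards [Ioo_mem_nhds hs.1 hs.2] with y hy
      exact hα.eq_one y (abs_le.2 ⟨hy.1.le, hy.2.le⟩)
    show deriv α s = 0
    rw [this.deriv_eq, deriv_const]
  -- The endpoints `±2`, near which `α` is not constant, are reached by continuity of the
  -- derivative.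
  have := closure_minimal hsub hcl
  rw [closure_Ioo (by norm_num)] at this
  exact this (abs_le.1 hr)

theorem IsCylindricalProfile.one_lt {α : ℝ → ℝ} (hα : IsCylindricalProfile α) {r : ℝ}
    (hr : 2 < |r|) : 1 < α r := by
  rcases lt_abs.1 hr with h | h
  · have hm : StrictMonoOn α (Ici 2) := by
      refine strictMonoOn_of_deriv_pos (convex_Ici 2) hα.smooth.continuous.continuousOn ?_
      intro x hx
      rw [interior_Ici] at hx
      have hx : 2 < x := hx
      have := hα.mul_deriv_pos x (lt_abs.2 (Or.inl hx))
      exact pos_of_mul_pos_right this (by linarith)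
    have := hm (self_mem_Ici) h.le h
    rwa [hα.eq_one 2 (by norm_num)] at this
  · have hm : StrictAntiOn α (Iic (-2)) := by
      refine strictAntiOn_of_deriv_neg (convex_Iic (-2)) hα.smooth.continuous.continuousOn ?_
      intro x hx
      rw [interior_Iic] at hx
      have hx : x < -2 := hx
      have := hα.mul_deriv_pos x (lt_abs.2 (Or.inr (by linarith)))
      nlinarith
    have := hm (show r ∈ Iic (-2) by simp; linarith) (self_mem_Iic) (show r < -2 by linarith)
    rwa [hα.eq_one (-2) (by norm_num)] at this

theorem IsCylindricalProfile.one_le {α : ℝ → ℝ} (hα : IsCylindricalProfile α) (r : ℝ) :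
    1 ≤ α r := by
  rcases le_or_gt |r| 2 with h | h
  · exact (hα.eq_one r h).ge
  · exact (hα.one_lt h).le

theorem IsCylindricalProfile.force_eq_zero {α : ℝ → ℝ} (hα : IsCylindricalProfile α) {r : ℝ}
    (hr : |r| ≤ 2) : force α r = 0 := by
  simp [force, hα.deriv_eq_zero hr]

theorem IsCylindricalProfile.mul_force_pos {α : ℝ → ℝ} (hα : IsCylindricalProfile α) {r : ℝ}
    (hr : 2 < |r|) : 0 < r * force α r := by
  rw [force, ← mul_div_assoc]
  exact div_pos (hα.mul_deriv_pos r hr) (pow_pos (hα.pos r) 3)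

theorem IsCylindricalProfile.mul_force_nonneg {α : ℝ → ℝ} (hα : IsCylindricalProfile α) (r : ℝ) :
    0 ≤ r * force α r := by
  rcases le_or_gt |r| 2 with h | h
  · simp [hα.force_eq_zero h]
  · exact (hα.mul_force_pos h).le

theorem IsCylindricalProfile.contDiff_force {α : ℝ → ℝ} (hα : IsCylindricalProfile α) :
    ContDiff ℝ 1 (force α) := by
  have h1 : ContDiff ℝ 1 (deriv α) := by
    have h2 : ContDiff ℝ (1 + 1) α := hα.smooth.of_le (by norm_cast)
    exact (contDiff_succ_iff_deriv.1 h2).2.2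
  have h3 : ContDiff ℝ 1 α := hα.smooth.of_le (by exact_mod_cast le_top)
  exact h1.div (h3.pow 3) fun x => (pow_pos (hα.pos x) 3).ne'

theorem IsCylindricalProfile.force_eventuallyEq {α : ℝ → ℝ} (hα : IsCylindricalProfile α) {r : ℝ}
    (hr : 4 < |r|) : force α =ᶠ[𝓝 r] fun y => (y ^ 3)⁻¹ := by
  have hopen : IsOpen {y : ℝ | 4 < |y|} := isOpen_lt continuous_const continuous_abs
  filter_upwards [hopen.mem_nhds hr] with y hy
  have hy : 4 < |y| := hy
  have hev : α =ᶠ[𝓝 y] fun z => |z| := by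
    filter_upwards [hopen.mem_nhds hy] with z hz
    exact hα.eq_abs z (le_of_lt hz)
  have hy0 : y ≠ 0 := by rintro rfl; norm_num at hy
  rw [force, hev.deriv_eq, hev.eq_of_nhds, deriv_abs]
  rcases lt_or_gt_of_ne hy0 with h | h
  · rw [abs_of_neg h, sign_neg h]
    field_simp
    simp
  · rw [abs_of_pos h, sign_pos h]
    simp

/-- The derivative is bounded on `[-4, 4]` by compactness; beyond, the force is `r⁻³` and its
derivative `-3/r⁴` is at most `1` in absolute value. -/
theorem IsCylindricalProfile.lipschitz_force {α : ℝ → ℝ} (hα : IsCylindricalProfile α) :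
    ∃ K : ℝ≥0, LipschitzWith K (force α) := by
  have hc : Continuous (deriv (force α)) := hα.contDiff_force.continuous_deriv (by simp)
  obtain ⟨C, hC⟩ := (isCompact_Icc (a := (-4 : ℝ)) (b := 4)).exists_bound_of_continuousOn
    hc.continuousOn
  refine ⟨(max C 1).toNNReal, lipschitzWith_of_nnnorm_deriv_le
    (hα.contDiff_force.differentiable (by simp)) fun x => ?_⟩
  rw [← NNReal.coe_le_coe, coe_nnnorm, Real.coe_toNNReal _ (le_max_of_le_right zero_le_one)]
  rcases le_or_gt |x| 4 with h | h
  · exact (hC x (abs_le.1 h)).trans (le_max_left _ _)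
  · refine le_trans ?_ (le_max_right _ _)
    have hx0 : x ≠ 0 := by rintro rfl; norm_num at h
    have hd : HasDerivAt (fun y : ℝ => (y ^ 3)⁻¹) (-(3 * x ^ 2) / (x ^ 3) ^ 2) x := by
      have := (hasDerivAt_pow 3 x).fun_inv (pow_ne_zero 3 hx0)
      simpa using this
    rw [(hα.force_eventuallyEq h).deriv_eq, hd.deriv]
    have h1 : -(3 * x ^ 2) / (x ^ 3) ^ 2 = -(3 / x ^ 4) := by field_simp
    have h4 : (4 : ℝ) ^ 4 ≤ x ^ 4 := by
      rw [← Even.pow_abs (by decide : Even 4) x]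
      gcongr
    rw [h1, norm_neg, Real.norm_of_nonneg (by positivity), div_le_one (by positivity)]
    linarith

/-- `(r, v)` is the radial position and velocity of a geodesic of unit speed, `c` being the square
of its angular momentum. -/
structure IsTrajectory (α : ℝ → ℝ) (c : ℝ) (r v : ℝ → ℝ) : Prop where
  hasDerivAt_pos : ∀ t, HasDerivAt r (v t) t
  hasDerivAt_vel : ∀ t, HasDerivAt v (c * force α (r t)) t
  energy : ∀ t, v t ^ 2 + c / α (r t) ^ 2 = 1

/-- The vector field of the radial equation of motion. -/
def radialField (α : ℝ → ℝ) (c : ℝ) (x : ℝ × ℝ) : ℝ × ℝ := (x.2, c * force α x.1)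

theorem IsCylindricalProfile.lipschitz_radialField {α : ℝ → ℝ} (hα : IsCylindricalProfile α)
    (c : ℝ) : ∃ K : ℝ≥0, LipschitzWith K (radialField α c) := by
  obtain ⟨K, hK⟩ := hα.lipschitz_force
  refine ⟨_, LipschitzWith.prod_snd.prodMk
    (LipschitzWith.comp (Kf := ‖c‖₊) ?_ (hK.comp LipschitzWith.prod_fst))⟩
  refine LipschitzWith.of_dist_le_mul fun x y => ?_
  simp [Real.dist_eq, ← mul_sub, abs_mul]

theorem IsCylindricalProfile.exists_radial_solution {α : ℝ → ℝ} (hα : IsCylindricalProfile α)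
    (c r₀ v₀ : ℝ) : ∃ r v : ℝ → ℝ, r 0 = r₀ ∧ v 0 = v₀ ∧ (∀ t, HasDerivAt r (v t) t) ∧
      ∀ t, HasDerivAt v (c * force α (r t)) t := by
  obtain ⟨K, hK⟩ := hα.lipschitz_radialField c
  have hV : ContDiff ℝ 1 (radialField α c) :=
    contDiff_snd.prodMk (contDiff_const.mul (hα.contDiff_force.comp contDiff_fst))
  obtain ⟨γ, h0, hγ⟩ := exists_integralCurve_of_lipschitz hV hK (r₀, v₀)
  refine ⟨fun t => (γ t).1, fun t => (γ t).2, by simp [h0], by simp [h0], fun t => ?_, fun t => ?_⟩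
  · exact (hγ t).fst
  · exact (hγ t).snd

/-- In the cylindrical part a trajectory moves with constant velocity. -/
theorem IsTrajectory.eq_line {α : ℝ → ℝ} (hα : IsCylindricalProfile α) {c : ℝ} {r v : ℝ → ℝ}
    (h : IsTrajectory α c r v) {t : ℝ} (ht : 0 ≤ t)
    (hline : ∀ s ∈ Icc 0 t, |r 0 + v 0 * s| ≤ 2) :
    r t = r 0 + v 0 * t ∧ v t = v 0 := by
  obtain ⟨K, hK⟩ := hα.lipschitz_radialField c
  -- The line solves the same equation because the force vanishes along it.
  have key := ODE_solution_unique (v := fun _ => radialField α c) (K := K)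
    (f := fun s => (r s, v s)) (g := fun s => (r 0 + v 0 * s, v 0)) (a := 0) (b := t)
    (fun _ => hK) (fun s _ => ?_) (fun s _ => ?_) (fun s _ => ?_) (fun s hs => ?_) (by simp)
  · have := key (right_mem_Icc.2 ht)
    simpa using this
  · exact ((h.hasDerivAt_pos s).continuousAt.prodMk
      (h.hasDerivAt_vel s).continuousAt).continuousWithinAt
  · exact ((h.hasDerivAt_pos s).prodMk (h.hasDerivAt_vel s)).hasDerivWithinAt
  · exact Continuous.continuousWithinAt (by fun_prop)
  · have hz : radialField α c (r 0 + v 0 * s, v 0) = (v 0, 0) := by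
      simp [radialField, hα.force_eq_zero (hline s (Ico_subset_Icc_self hs))]
    rw [hz]
    have h1 : HasDerivAt (fun s => r 0 + v 0 * s) (v 0) s := by
      simpa using ((hasDerivAt_id s).const_mul (v 0)).const_add (r 0)
    exact (h1.prodMk (hasDerivAt_const s (v 0))).hasDerivWithinAt

theorem IsTrajectory.reverse {α : ℝ → ℝ} {c : ℝ} {r v : ℝ → ℝ} (h : IsTrajectory α c r v) :
    IsTrajectory α c (fun t => r (-t)) (fun t => -v (-t)) where
  hasDerivAt_pos t := by
    simpa [Function.comp_def] using (h.hasDerivAt_pos (-t)).comp t (hasDerivAt_neg t)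
  hasDerivAt_vel t := by
    simpa [Function.comp_def] using ((h.hasDerivAt_vel (-t)).comp t (hasDerivAt_neg t)).fun_neg
  energy t := by simpa using h.energy (-t)

theorem IsTrajectory.shift {α : ℝ → ℝ} {c : ℝ} {r v : ℝ → ℝ} (h : IsTrajectory α c r v) (a : ℝ) :
    IsTrajectory α c (fun t => r (t + a)) (fun t => v (t + a)) where
  hasDerivAt_pos t := (h.hasDerivAt_pos (t + a)).comp_add_const t a
  hasDerivAt_vel t := (h.hasDerivAt_vel (t + a)).comp_add_const t a
  energy t := h.energy (t + a)

/-- A trajectory at rest in the cylindrical part is at rest for ever. -/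
theorem IsTrajectory.eq_const {α : ℝ → ℝ} (hα : IsCylindricalProfile α) {c : ℝ} {r v : ℝ → ℝ}
    (h : IsTrajectory α c r v) {s : ℝ} (hr : |r s| ≤ 2) (hv : v s = 0) (t : ℝ) :
    r t = r s ∧ v t = 0 := by
  rcases le_total s t with hst | hst
  · have := (h.shift s).eq_line hα (t := t - s) (by linarith) (by simpa [hv] using fun _ _ _ => hr)
    simpa [hv] using this
  · have := (h.shift s).reverse.eq_line hα (t := s - t) (by linarith)
      (by simpa [hv] using fun _ _ _ => hr)
    simpa [hv] using this

end Revolution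

/-! ### Reduction of the geodesic flow to the radial equation -/

namespace Revolution

theorem symbol_sq {d : ℕ} (α : ℝ → ℝ) (x : Phase d) :
    symbol α x ^ 2 = x.2.1 ^ 2 + (α x.1.1)⁻¹ ^ 2 * ‖x.2.2‖ ^ 2 :=
  Real.sq_sqrt (by positivity)

theorem symbol_pos {d : ℕ} {α : ℝ → ℝ} {x : Phase d} (hα : 0 < α x.1.1) (hx : x ∈ cotangent d) :
    0 < symbol α x := by
  have h0 : 0 ≤ symbol α x := Real.sqrt_nonneg _
  refine h0.lt_of_ne fun h => hx.2.2 ?_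
  have h1 := symbol_sq α x
  rw [← h] at h1
  have h2 : 0 ≤ (α x.1.1)⁻¹ ^ 2 * ‖x.2.2‖ ^ 2 := by positivity
  have h3 : x.2.1 = 0 := by nlinarith [sq_nonneg x.2.1]
  have h4 : (α x.1.1)⁻¹ ^ 2 * ‖x.2.2‖ ^ 2 = 0 := by nlinarith [sq_nonneg x.2.1]
  have h5 : x.2.2 = 0 := by simpa [hα.ne'] using h4
  exact Prod.ext h3 h5

theorem differentiableAt_symbol {d : ℕ} {α : ℝ → ℝ} (hα : IsCylindricalProfile α) {x : Phase d}
    (hx : x ∈ cotangent d) : DifferentiableAt ℝ (symbol α) x := by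
  have hp := symbol_pos (hα.pos _) hx
  have h1 : DifferentiableAt ℝ (fun y : Phase d => (α y.1.1)⁻¹) x :=
    ((hα.differentiable _).comp x (by fun_prop)).inv (hα.pos _).ne'
  have h2 : DifferentiableAt ℝ (fun y : Phase d => ‖y.2.2‖ ^ 2) x :=
    DifferentiableAt.norm_sq ℝ (by fun_prop)
  have h3 : DifferentiableAt ℝ
      (fun y : Phase d => y.2.1 ^ 2 + (α y.1.1)⁻¹ ^ 2 * ‖y.2.2‖ ^ 2) x :=
    DifferentiableAt.add (by fun_prop) ((h1.pow 2).mul h2)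
  exact h3.sqrt (Real.sqrt_pos.1 hp).ne'

theorem fderiv_symbol {d : ℕ} {α : ℝ → ℝ} (hα : IsCylindricalProfile α) {x : Phase d}
    (hx : x ∈ cotangent d) (u : Phase d) :
    fderiv ℝ (symbol α) x u = (x.2.1 * u.2.1 - force α x.1.1 * ‖x.2.2‖ ^ 2 * u.1.1
      + (α x.1.1)⁻¹ ^ 2 * ⟪x.2.2, u.2.2⟫) / symbol α x := by
  have hp := symbol_pos (hα.pos _) hx
  rw [← (differentiableAt_symbol hα hx).lineDeriv_eq_fderiv]
  have hlin : ∀ a b : ℝ, HasDerivAt (fun s : ℝ => a + s * b) b 0 := fun a b => by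
    simpa using ((hasDerivAt_id (0 : ℝ)).mul_const b).const_add a
  have h1 : HasDerivAt (fun s : ℝ => α (x.1.1 + s * u.1.1)) (deriv α x.1.1 * u.1.1) 0 := by
    have := (hα.differentiable (x.1.1 + 0 * u.1.1)).hasDerivAt.comp 0 (hlin x.1.1 u.1.1)
    simpa [Function.comp_def] using this
  have h2 : HasDerivAt (fun s : ℝ => ‖x.2.2 + s • u.2.2‖ ^ 2) (2 * ⟪x.2.2, u.2.2⟫) 0 := by
    have := (((hasDerivAt_id (0 : ℝ)).smul_const u.2.2).const_add x.2.2).norm_sq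
    simpa using this
  have h3 := (((hlin x.2.1 u.2.1).fun_pow 2).fun_add
    (((h1.fun_inv (by simpa using (hα.pos _).ne')).fun_pow 2).fun_mul h2)).sqrt
    (by simpa using (Real.sqrt_pos.1 hp).ne')
  refine HasDerivAt.deriv (h3.congr_deriv ?_)
  have hs : Real.sqrt (x.2.1 ^ 2 + (α x.1.1)⁻¹ ^ 2 * ‖x.2.2‖ ^ 2) = symbol α x := rfl
  have hA := (hα.pos x.1.1).ne'
  simp only [zero_mul, add_zero, zero_smul, force, hs, Nat.reduceSub, pow_one, Nat.cast_ofNat]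
  field_simp
  ring

/-- The radial motion of an integral curve of `H_p`. -/
theorem IsHamiltonCurve.isTrajectory {d : ℕ} {α : ℝ → ℝ} (hα : IsCylindricalProfile α)
    {γ : ℝ → Phase d} (hγ : IsHamiltonCurve α γ) :
    IsTrajectory α (‖(γ 0).2.2‖ ^ 2 / symbol α (γ 0) ^ 2) (fun t => (γ t).1.1)
      (fun t => (γ t).2.1 / symbol α (γ 0)) := by
  obtain ⟨hcot, hham⟩ := hγ
  choose H hH hω using hham
  have hr : ∀ t, HasDerivAt (fun t => (γ t).1.1) (H t).1.1 t := fun t => (hH t).fst.fst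
  have hθ : ∀ t, HasDerivAt (fun t => (γ t).1.2) (H t).1.2 t := fun t => (hH t).fst.snd
  have hρ : ∀ t, HasDerivAt (fun t => (γ t).2.1) (H t).2.1 t := fun t => (hH t).snd.fst
  have hη : ∀ t, HasDerivAt (fun t => (γ t).2.2) (H t).2.2 t := fun t => (hH t).snd.snd
  -- Differentiating `‖θ‖² = 1` and `⟪θ, η⟫ = 0` along the curve. This makes the velocity itself an
  -- admissible test vector.
  have htan : ∀ t, H t ∈ tangentT (γ t) := by
    intro t
    constructor
    · have h1 := (hθ t).norm_sq
      have h2 : (fun t => ‖(γ t).1.2‖ ^ 2) = fun _ => 1 := by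
        funext s
        rw [show ‖(γ s).1.2‖ = 1 from (hcot s).1, one_pow]
      rw [h2] at h1
      have := h1.unique (hasDerivAt_const t 1)
      linarith
    · have h1 := (hθ t).inner ℝ (hη t)
      have h2 : (fun t => ⟪(γ t).1.2, (γ t).2.2⟫) = fun _ => 0 := by
        funext s
        exact (hcot s).2.1
      rw [h2] at h1
      have := h1.unique (hasDerivAt_const t 0)
      linarith
  have hsymb : ∀ t, symbol α (γ t) = symbol α (γ 0) := by
    intro t
    have hd : ∀ s, HasDerivAt (fun s => symbol α (γ s)) 0 s := by
      intro s
      have h1 := (differentiableAt_symbol hα (hcot s)).hasFDerivAt.comp_hasDerivAt s (hH s)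
      refine h1.congr_deriv ?_
      -- Conservation of `p`: testing with `H` gives `dp(H) = ω(H, H) = 0`.
      rw [← hω s (H s) (htan s)]
      simp only [symplectic]
      rw [real_inner_comm]
      ring
    exact is_const_of_deriv_eq_zero (fun s => (hd s).differentiableAt) (fun s => (hd s).deriv) t 0
  have hang : ∀ t, ‖(γ t).2.2‖ ^ 2 = ‖(γ 0).2.2‖ ^ 2 := by
    intro t
    have hd : ∀ s, HasDerivAt (fun s => ‖(γ s).2.2‖ ^ 2) 0 s := by
      intro s
      refine (hη s).norm_sq.congr_deriv ?_
      have hc : ⟪(γ s).1.2, (γ s).2.2⟫ = 0 := (hcot s).2.1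
      have hn : ‖(γ s).1.2‖ = 1 := (hcot s).1
      -- The test vector generates the rotation in the plane of `θ` and `η`. It annihilates `dp`,
      -- and its pairing with `H` is `-⟪η, η'⟫`; so `‖η‖` is conserved.
      have hu := hω s ((0, (γ s).2.2), (0, -(‖(γ s).2.2‖ ^ 2) • (γ s).1.2)) (by
        refine ⟨hc, ?_⟩
        simp only [inner_smul_right, real_inner_self_eq_norm_sq, hn]
        ring)
      rw [fderiv_symbol hα (hcot s)] at hu
      simp only [symplectic, inner_smul_left, inner_smul_right] at hu
      rw [real_inner_comm] at hc
      have h0 := (htan s).1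
      rw [h0, hc] at hu
      simp at hu
      rw [hu, mul_zero]
    exact is_const_of_deriv_eq_zero (f := fun s => ‖(γ s).2.2‖ ^ 2)
      (fun s => (hd s).differentiableAt) (fun s => (hd s).deriv) t 0
  have hp := symbol_pos (hα.pos _) (hcot 0)
  refine ⟨fun t => ?_, fun t => ?_, fun t => ?_⟩
  · refine (hr t).congr_deriv ?_
    have hu := hω t ((0, 0), (1, 0)) (by simp [tangentT])
    rw [fderiv_symbol hα (hcot t), hsymb t] at hu
    simpa [symplectic] using hu
  · refine ((hρ t).div_const _).congr_deriv ?_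
    have hu := hω t ((1, 0), (0, 0)) (by simp [tangentT])
    rw [fderiv_symbol hα (hcot t), hsymb t, hang t] at hu
    simp [symplectic] at hu
    have h1 : (H t).2.1 = force α (γ t).1.1 * ‖(γ 0).2.2‖ ^ 2 / symbol α (γ 0) := by
      rw [← neg_inj, hu]
      ring
    rw [h1]
    field_simp
  · have h1 := symbol_sq α (γ t)
    rw [hsymb t, hang t] at h1
    have hA := (hα.pos (γ t).1.1).ne'
    field_simp
    field_simp at h1
    linarith

/-- A unit vector orthogonal to `θ` and parallel to a given vector `η ⟂ θ`. -/
theorem exists_unit_direction {d : ℕ} (hd : 2 ≤ d) {θ η : E d} (h : ⟪θ, η⟫ = 0) :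
    ∃ e : E d, ‖e‖ = 1 ∧ ⟪θ, e⟫ = 0 ∧ η = ‖η‖ • e := by
  rcases eq_or_ne η 0 with rfl | hη
  -- For `η = 0` any unit vector orthogonal to `θ` serves; one exists because `d ≥ 2`.
  · have hlt : (ℝ ∙ θ) < ⊤ := by
      refine Submodule.lt_top_of_finrank_lt_finrank ?_
      refine (finrank_span_le_card {θ}).trans_lt ?_
      simp
      omega
    have hne : (ℝ ∙ θ)ᗮ ≠ ⊥ := by
      rw [Ne, Submodule.orthogonal_eq_bot_iff]
      exact hlt.ne
    obtain ⟨w, hw, hw0⟩ := Submodule.exists_mem_ne_zero_of_ne_bot hne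
    rw [Submodule.mem_orthogonal_singleton_iff_inner_right] at hw
    refine ⟨‖w‖⁻¹ • w, norm_smul_inv_norm hw0, ?_, by simp⟩
    rw [inner_smul_right, hw, mul_zero]
  · refine ⟨‖η‖⁻¹ • η, norm_smul_inv_norm hη, by rw [inner_smul_right, h, mul_zero], ?_⟩
    rw [smul_smul, mul_inv_cancel₀ (norm_ne_zero_iff.2 hη), one_smul]

/-- The geodesic flow is complete. -/
theorem exists_hamiltonCurve {d : ℕ} (hd : 2 ≤ d) {α : ℝ → ℝ} (hα : IsCylindricalProfile α)
    {x : Phase d} (hx : x ∈ cotangent d) :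
    ∃ γ : ℝ → Phase d, IsHamiltonCurve α γ ∧ γ 0 = x := by
  obtain ⟨e, he, hθe, hηe⟩ := exists_unit_direction hd hx.2.1
  have hp := symbol_pos (hα.pos _) hx
  have hpsq := symbol_sq α x
  have hθ : ‖x.1.2‖ = 1 := hx.1
  set p := symbol α x
  set L := ‖x.2.2‖
  obtain ⟨r, v, hr0, hv0, hr, hv⟩ := hα.exists_radial_solution (L ^ 2 / p ^ 2) x.1.1 (x.2.1 / p)
  have hA : ∀ t, α (r t) ≠ 0 := fun t => (hα.pos _).ne'
  have hcons : ∀ t, (p * v t) ^ 2 + (α (r t))⁻¹ ^ 2 * L ^ 2 = p ^ 2 := by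
    have hd : ∀ s, HasDerivAt (fun s => (p * v s) ^ 2 + (α (r s))⁻¹ ^ 2 * L ^ 2) 0 s := by
      intro s
      have h1 := ((hα.differentiable (r s)).hasDerivAt.comp s (hr s)).fun_inv (hA s)
      refine ((((hv s).const_mul p).fun_pow 2).fun_add
        ((h1.fun_pow 2).mul_const (L ^ 2))).congr_deriv ?_
      have := hA s
      simp only [force, Function.comp, Nat.reduceSub, pow_one, Nat.cast_ofNat]
      field_simp
      ring
    intro t
    have := is_const_of_deriv_eq_zero (fun s => (hd s).differentiableAt) (fun s => (hd s).deriv) t 0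
    rw [this, hr0, hv0, mul_div_cancel₀ _ hp.ne', hpsq]
  have hcont : Continuous fun t => L / (α (r t) ^ 2 * p) := by
    have : Continuous r := continuous_iff_continuousAt.2 fun t => (hr t).continuousAt
    exact continuous_const.div (((hα.smooth.continuous.comp this).pow 2).mul continuous_const)
      fun t => mul_ne_zero (pow_ne_zero 2 (hA t)) hp.ne'
  -- The spherical part runs along the great circle through `θ` in the direction `e`, with angular
  -- speed `L/(α² p)`.
  set φ : ℝ → ℝ := fun t => ∫ s in (0 : ℝ)..t, L / (α (r s) ^ 2 * p)
  have hφ : ∀ t, HasDerivAt φ (L / (α (r t) ^ 2 * p)) t := fun t =>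
    intervalIntegral.integral_hasDerivAt_right (hcont.intervalIntegrable _ _)
      (hcont.stronglyMeasurableAtFilter _ _) hcont.continuousAt
  have hφ0 : φ 0 = 0 := intervalIntegral.integral_same
  have hc : ∀ t, HasDerivAt (fun t => Real.cos (φ t)) (-Real.sin (φ t) * (L / (α (r t) ^ 2 * p))) t :=
    fun t => (hφ t).cos
  have hs : ∀ t, HasDerivAt (fun t => Real.sin (φ t)) (Real.cos (φ t) * (L / (α (r t) ^ 2 * p))) t :=
    fun t => (hφ t).sin
  set Θ : ℝ → E d := fun t => Real.cos (φ t) • x.1.2 + Real.sin (φ t) • e with hΘ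
  set N : ℝ → E d := fun t => -Real.sin (φ t) • x.1.2 + Real.cos (φ t) • e with hN
  have heθ : ⟪e, x.1.2⟫ = 0 := by rw [real_inner_comm]; exact hθe
  have hΘΘ : ∀ t, ‖Θ t‖ ^ 2 = 1 := by
    intro t
    rw [← real_inner_self_eq_norm_sq]
    simp only [hΘ, inner_add_left, inner_add_right, real_inner_smul_left, real_inner_smul_right,
      real_inner_self_eq_norm_sq, norm_smul, Real.norm_eq_abs, mul_pow, sq_abs, hθ, he, hθe,
      heθ]
    linarith [Real.sin_sq_add_cos_sq (φ t)]
  have hNN : ∀ t, ‖N t‖ ^ 2 = 1 := by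
    intro t
    rw [← real_inner_self_eq_norm_sq]
    simp only [hN, inner_add_left, inner_add_right, real_inner_smul_left, real_inner_smul_right,
      real_inner_self_eq_norm_sq, norm_smul, Real.norm_eq_abs, mul_pow, sq_abs, hθ, he, hθe,
      heθ]
    linarith [Real.sin_sq_add_cos_sq (φ t)]
  have hΘN : ∀ t, ⟪Θ t, N t⟫ = 0 := by
    intro t
    simp only [hΘ, hN, inner_add_left, inner_add_right, real_inner_smul_left,
      real_inner_smul_right, real_inner_self_eq_norm_sq, hθ, he, hθe, heθ]
    ring
  have hL0 : 0 ≤ L := norm_nonneg _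
  have hnorm : ∀ t, ‖L • N t‖ ^ 2 = L ^ 2 := by
    intro t
    rw [norm_smul, mul_pow, hNN, Real.norm_of_nonneg hL0, mul_one]
  set γ : ℝ → Phase d := fun t => ((r t, Θ t), (p * v t, L • N t)) with hγ
  have hγcot : ∀ t, γ t ∈ cotangent d := by
    intro t
    refine ⟨?_, ?_, fun h => ?_⟩
    · have := hΘΘ t
      exact (pow_eq_one_iff_of_nonneg (norm_nonneg _) two_ne_zero).1 this
    · show ⟪Θ t, L • N t⟫ = 0
      rw [real_inner_smul_right, hΘN, mul_zero]
    · have h1 : p * v t = 0 := congrArg Prod.fst h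
      have h2 : L • N t = 0 := congrArg Prod.snd h
      have h3 := hnorm t
      rw [h2, norm_zero] at h3
      have h4 := hcons t
      rw [h1, ← h3] at h4
      have : 0 < p ^ 2 := by positivity
      norm_num at h4
      linarith
  have hγp : ∀ t, symbol α (γ t) = p := by
    intro t
    have h1 := symbol_sq α (γ t)
    have h2 : symbol α (γ t) ^ 2 = p ^ 2 := by
      rw [h1, ← hcons t, ← hnorm t]
    exact (sq_eq_sq₀ (symbol_pos (hα.pos _) (hγcot t)).le hp.le).1 h2
  refine ⟨γ, ⟨hγcot, fun t => ?_⟩, ?_⟩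
  · refine ⟨((v t, (L / (α (r t) ^ 2 * p)) • N t),
      (p * (L ^ 2 / p ^ 2 * force α (r t)), -(L * (L / (α (r t) ^ 2 * p))) • Θ t)), ?_, ?_⟩
    · refine ((hr t).prodMk ?_).prodMk (((hv t).const_mul p).prodMk ?_)
      · refine (((hc t).smul_const x.1.2).fun_add ((hs t).smul_const e)).congr_deriv ?_
        simp only [hN]
        module
      · refine ((((hs t).fun_neg.smul_const x.1.2).fun_add
          ((hc t).smul_const e)).fun_const_smul L).congr_deriv ?_
        simp only [hΘ]
        module
    · intro u hu
      rw [fderiv_symbol hα (hγcot t), hγp]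
      have h1 : ⟪Θ t, u.1.2⟫ = 0 := hu.1
      rw [real_inner_comm] at h1
      have h2 : ‖(γ t).2.2‖ ^ 2 = L ^ 2 := hnorm t
      rw [h2]
      have := hA t
      simp only [symplectic, hγ, real_inner_smul_right, real_inner_smul_left, h1]
      rw [real_inner_comm]
      field_simp
      ring
  · have h1 : Θ 0 = x.1.2 := by simp [hΘ, hφ0]
    have h2 : L • N 0 = x.2.2 := by
      conv_rhs => rw [hηe]
      simp [hN, hφ0]
    simp only [hγ, hr0, hv0, h1, h2, mul_div_cancel₀ _ hp.ne']

/-- The radial motion under the geodesic flow. -/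
theorem exists_trajectory_flow {d : ℕ} (hd : 2 ≤ d) {α : ℝ → ℝ} (hα : IsCylindricalProfile α)
    {x : Phase d} (hx : x ∈ cotangent d) :
    (∀ t, flow α t x ∈ cotangent d) ∧
      ∃ v : ℝ → ℝ, IsTrajectory α (‖x.2.2‖ ^ 2 / symbol α x ^ 2) (fun t => (flow α t x).1.1) v ∧
        (flow α 0 x).1.1 = x.1.1 ∧ v 0 = x.2.1 / symbol α x := by
  -- Existence rules out the default value of `flow`. Uniqueness is not needed, because the radial
  -- equation holds for whichever integral curve was chosen.
  have h := exists_hamiltonCurve hd hα hx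
  have hflow : ∀ t, flow α t x = h.choose t := fun t => by rw [flow, dif_pos h]
  obtain ⟨hγ, h0⟩ := h.choose_spec
  simp only [hflow]
  have := hγ.isTrajectory hα
  rw [h0] at this
  exact ⟨hγ.1, _, this, by rw [h0], by simp [h0]⟩

end Revolution

/-! ### Convexity of `r²`, transit times and the trapped set -/

namespace Revolution

/-- The time for which a geodesic of unit speed and squared angular momentum `c` stays in the
region `{|r| ≤ 3}` is at most twice this integral. -/
def transitTime (α : ℝ → ℝ) (c : ℝ) : ℝ≥0∞ :=
  ∫⁻ y in Icc (-3 : ℝ) 3, ENNReal.ofReal (Real.sqrt (1 - c / α y ^ 2))⁻¹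

namespace IsTrajectory

variable {α : ℝ → ℝ} {c : ℝ} {r v : ℝ → ℝ}

theorem hasDerivAt_sq (h : IsTrajectory α c r v) (t : ℝ) :
    HasDerivAt (fun s => r s ^ 2) (2 * (r t * v t)) t :=
  ((h.hasDerivAt_pos t).fun_pow 2).congr_deriv (by norm_num; ring)

theorem hasDerivAt_mul (h : IsTrajectory α c r v) (t : ℝ) :
    HasDerivAt (fun s => r s * v s) (v t ^ 2 + c * (r t * force α (r t))) t :=
  ((h.hasDerivAt_pos t).fun_mul (h.hasDerivAt_vel t)).congr_deriv (by ring)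

/-- The derivative `v² + c r α'/α³` can vanish only where `v = 0` and the second term is zero. There
`c > 0` by the energy identity, so `|r| ≤ 2`, and the trajectory would be at rest for ever. -/
theorem strictMono_mul (h : IsTrajectory α c r v) (hα : IsCylindricalProfile α) (hc : 0 ≤ c)
    (hne : 2 < |r 0| ∨ v 0 ≠ 0) : StrictMono fun s => r s * v s := by
  refine strictMono_of_deriv_pos fun s => ?_
  rw [(h.hasDerivAt_mul s).deriv]
  have h1 : 0 ≤ c * (r s * force α (r s)) := mul_nonneg hc (hα.mul_force_nonneg _)
  by_cases hv : v s = 0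
  · have hr : 2 < |r s| := by
      by_contra! hr
      obtain ⟨h2, h3⟩ := h.eq_const hα hr hv 0
      rw [h2] at hne
      rcases hne with hne | hne
      · linarith
      · exact hne h3
    have hc0 : 0 < c := by
      refine hc.lt_of_ne fun hc0 => ?_
      have := h.energy s
      rw [← hc0, hv] at this
      norm_num at this
    have := mul_pos hc0 (hα.mul_force_pos hr)
    nlinarith [sq_nonneg (v s)]
  · have : 0 < v s ^ 2 := by positivity
    linarith

/-- A trajectory that does not move inwards, and is not at rest in the cylindrical part, escapes. -/
theorem tendsto_abs_atTop (h : IsTrajectory α c r v) (hα : IsCylindricalProfile α) (hc : 0 ≤ c)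
    (hne : 2 < |r 0| ∨ v 0 ≠ 0) (h0 : 0 ≤ r 0 * v 0) : Tendsto (fun t => |r t|) atTop atTop := by
  have hmono := h.strictMono_mul hα hc hne
  have hpos : 0 < r 1 * v 1 := h0.trans_lt (hmono zero_lt_one)
  -- After time `1` the derivative `2 r v` of `r²` exceeds its positive value at time `1`, so `r²`
  -- grows at least linearly.
  have hd : ∀ s, HasDerivAt (fun s => r s ^ 2 - 2 * (r 1 * v 1) * s)
      (2 * (r s * v s) - 2 * (r 1 * v 1)) s := fun s => by
    simpa using (h.hasDerivAt_sq s).fun_sub ((hasDerivAt_id s).const_mul (2 * (r 1 * v 1)))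
  have hm : MonotoneOn (fun s => r s ^ 2 - 2 * (r 1 * v 1) * s) (Ici 1) := by
    refine monotoneOn_of_deriv_nonneg (convex_Ici 1)
      (fun s _ => (hd s).continuousAt.continuousWithinAt)
      (fun s _ => (hd s).differentiableAt.differentiableWithinAt) fun s hs => ?_
    rw [interior_Ici] at hs
    rw [(hd s).deriv]
    have : r 1 * v 1 < r s * v s := hmono hs
    linarith
  have hsq : Tendsto (fun t => r t ^ 2) atTop atTop := by
    have hlin : Tendsto (fun t : ℝ => 2 * (r 1 * v 1) * t + (r 1 ^ 2 - 2 * (r 1 * v 1) * 1))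
        atTop atTop :=
      tendsto_atTop_add_const_right _ _ (tendsto_id.const_mul_atTop (by positivity))
    refine tendsto_atTop_mono' _ ?_ hlin
    filter_upwards [eventually_ge_atTop 1] with t ht
    have := hm self_mem_Ici ht ht
    simp only at this
    linarith
  simpa [Function.comp_def, Real.sqrt_sq_eq_abs] using Real.tendsto_sqrt_atTop.comp hsq

/-- Half the second derivative of `r²` is `v² + c r α'/α³`. The case `m = 0` gives confinement
between two times, the case `m = 3/4` gives fast escape at small angular momentum. -/
theorem convexOn_sub (h : IsTrajectory α c r v) {m : ℝ}
    (hm : ∀ s, m ≤ v s ^ 2 + c * (r s * force α (r s))) :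
    ConvexOn ℝ univ fun s => r s ^ 2 - m * s ^ 2 := by
  have hd : ∀ s, HasDerivAt (fun s => r s ^ 2 - m * s ^ 2) (2 * (r s * v s - m * s)) s := fun s =>
    ((h.hasDerivAt_sq s).fun_sub ((hasDerivAt_pow 2 s).const_mul m)).congr_deriv
      (by norm_num; ring)
  have hd2 : ∀ s, HasDerivAt (fun s => 2 * (r s * v s - m * s))
      (2 * (v s ^ 2 + c * (r s * force α (r s)) - m)) s := fun s => by
    simpa using ((h.hasDerivAt_mul s).fun_sub ((hasDerivAt_id s).const_mul m)).const_mul 2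
  refine Monotone.convexOn_univ_of_deriv (fun s => (hd s).differentiableAt) ?_
  rw [show deriv (fun s => r s ^ 2 - m * s ^ 2) = fun s => 2 * (r s * v s - m * s) from
    funext fun s => (hd s).deriv]
  refine monotone_of_deriv_nonneg (fun s => (hd2 s).differentiableAt) fun s => ?_
  rw [(hd2 s).deriv]
  linarith [hm s]

theorem abs_le_three (h : IsTrajectory α c r v) (hα : IsCylindricalProfile α) (hc : 0 ≤ c)
    {t : ℝ} (h0 : |r 0| ≤ 3) (ht : |r t| ≤ 3) {s : ℝ} (hs : s ∈ Icc 0 t) : |r s| ≤ 3 := by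
  have hconv := h.convexOn_sub (m := 0) fun s =>
    add_nonneg (sq_nonneg _) (mul_nonneg hc (hα.mul_force_nonneg _))
  have h1 := hconv.le_max_of_mem_Icc (mem_univ 0) (mem_univ t) hs
  simp only [zero_mul, sub_zero] at h1
  have h2 : max (r 0 ^ 2) (r t ^ 2) ≤ 3 ^ 2 :=
    max_le (sq_le_sq.2 (by simpa using h0)) (sq_le_sq.2 (by simpa using ht))
  simpa using sq_le_sq.1 (h1.trans h2)

/-- If `c < 1/4` then `v² ≥ 3/4`, and convexity at the midpoint yields `r(t/2)² ≤ 9 - 3t²/16`, which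
is negative for `t ≥ 7`. -/
theorem quarter_le (h : IsTrajectory α c r v) (hα : IsCylindricalProfile α) (hc : 0 ≤ c)
    {t : ℝ} (h7 : 7 ≤ t) (h0 : |r 0| ≤ 3) (ht : |r t| ≤ 3) : 1 / 4 ≤ c := by
  by_contra! hc4
  have hconv := h.convexOn_sub (m := 3 / 4) fun s => by
    have h1 := mul_nonneg hc (hα.mul_force_nonneg (r s))
    have h2 := h.energy s
    have h3 : c / α (r s) ^ 2 ≤ c := div_le_self hc (one_le_pow₀ (hα.one_le _))
    linarith
  have h1 := hconv.2 (mem_univ (0 : ℝ)) (mem_univ t) (by norm_num : (0 : ℝ) ≤ 1 / 2)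
    (by norm_num : (0 : ℝ) ≤ 1 / 2) (by norm_num)
  simp only [smul_eq_mul] at h1
  have h2 : r 0 ^ 2 ≤ 3 ^ 2 := sq_le_sq.2 (by simpa using h0)
  have h3 : r t ^ 2 ≤ 3 ^ 2 := sq_le_sq.2 (by simpa using ht)
  nlinarith [sq_nonneg (r (1 / 2 * 0 + 1 / 2 * t))]

/-- Substitute `y = r s`: by the energy identity the integrand is `1/|v|`, which cancels the
Jacobian `|v|`. -/
theorem length_le_transitTime (h : IsTrajectory α c r v) {a b : ℝ}
    (hr : ∀ s ∈ Ioo a b, |r s| ≤ 3) (hv : ∀ s ∈ Ioo a b, v s ≠ 0) (hinj : InjOn r (Ioo a b)) :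
    ENNReal.ofReal (b - a) ≤ transitTime α c := by
  have key := lintegral_image_eq_lintegral_abs_deriv_mul measurableSet_Ioo
    (fun s (_ : s ∈ Ioo a b) => (h.hasDerivAt_pos s).hasDerivWithinAt) hinj
    (fun y => ENNReal.ofReal (Real.sqrt (1 - c / α y ^ 2))⁻¹)
  have hone : ∀ s ∈ Ioo a b,
      ENNReal.ofReal |v s| * ENNReal.ofReal (Real.sqrt (1 - c / α (r s) ^ 2))⁻¹ = 1 := by
    intro s hs
    rw [show 1 - c / α (r s) ^ 2 = v s ^ 2 by linarith [h.energy s], Real.sqrt_sq_eq_abs,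
      ← ENNReal.ofReal_mul (abs_nonneg _), mul_inv_cancel₀ (abs_ne_zero.2 (hv s hs)),
      ENNReal.ofReal_one]
  rw [setLIntegral_congr_fun measurableSet_Ioo hone, setLIntegral_one, Real.volume_Ioo] at key
  rw [← key]
  refine lintegral_mono_set ?_
  rintro _ ⟨s, hs, rfl⟩
  exact abs_le.1 (hr s hs)

/-- Since `r v` increases, its sign at `t/2` decides on which half of the interval it has constant
sign; there `r²` is strictly monotone, hence `r` is injective. -/
theorem half_le_transitTime (h : IsTrajectory α c r v) (hα : IsCylindricalProfile α) (hc : 0 ≤ c)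
    {t : ℝ} (htpos : 0 < t) (h0 : |r 0| ≤ 3) (ht : |r t| ≤ 3) (hv0 : v 0 ≠ 0) :
    ENNReal.ofReal (t / 2) ≤ transitTime α c := by
  have hmono := h.strictMono_mul hα hc (Or.inr hv0)
  have hcont : Continuous fun s => r s ^ 2 :=
    continuous_iff_continuousAt.2 fun s => (h.hasDerivAt_sq s).continuousAt
  rcases le_total 0 (r (t / 2) * v (t / 2)) with hm | hm
  · have hpos : ∀ s ∈ Ioo (t / 2) t, 0 < r s * v s := fun s hs => hm.trans_lt (hmono hs.1)
    have hsm : StrictMonoOn (fun s => r s ^ 2) (Ioo (t / 2) t) :=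
      strictMonoOn_of_deriv_pos (convex_Ioo _ _) hcont.continuousOn fun s hs => by
        rw [interior_Ioo] at hs
        rw [(h.hasDerivAt_sq s).deriv]
        linarith [hpos s hs]
    have := h.length_le_transitTime (a := t / 2) (b := t)
      (fun s hs => h.abs_le_three hα hc h0 ht ⟨by linarith [hs.1], hs.2.le⟩)
      (fun s hs => right_ne_zero_of_mul (hpos s hs).ne')
      (fun s hs s' hs' e => hsm.injOn hs hs' (by simp only [e]))
    rwa [show t - t / 2 = t / 2 by ring] at this
  · have hneg : ∀ s ∈ Ioo 0 (t / 2), r s * v s < 0 := fun s hs => (hmono hs.2).trans_le hm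
    have hsm : StrictAntiOn (fun s => r s ^ 2) (Ioo 0 (t / 2)) :=
      strictAntiOn_of_deriv_neg (convex_Ioo _ _) hcont.continuousOn fun s hs => by
        rw [interior_Ioo] at hs
        rw [(h.hasDerivAt_sq s).deriv]
        linarith [hneg s hs]
    have := h.length_le_transitTime (a := 0) (b := t / 2)
      (fun s hs => h.abs_le_three hα hc h0 ht ⟨hs.1.le, by linarith [hs.2]⟩)
      (fun s hs => right_ne_zero_of_mul (hneg s hs).ne)
      (fun s hs s' hs' e => hsm.injOn hs hs' (by simp only [e]))
    rwa [sub_zero] at this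

end IsTrajectory

/-- The trapped set is the set of closed geodesics of the cylindrical part. -/
theorem trappedSet_eq {d : ℕ} (hd : 2 ≤ d) {α : ℝ → ℝ} (hα : IsCylindricalProfile α) :
    trappedSet d α = {x | x ∈ cotangent d ∧ |x.1.1| ≤ 2 ∧ x.2.1 = 0} := by
  ext x
  by_cases hx : x ∈ cotangent d
  swap
  · exact ⟨fun h => absurd h.1.1 hx, fun h => absurd h.1 hx⟩
  obtain ⟨-, v, hv, hr0, hv0⟩ := exists_trajectory_flow hd hα hx
  have hp := symbol_pos (hα.pos _) hx
  have hc : 0 ≤ ‖x.2.2‖ ^ 2 / symbol α x ^ 2 := by positivity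
  constructor
  · rintro ⟨⟨-, hplus⟩, -, hminus⟩
    refine ⟨hx, ?_⟩
    by_contra hcon
    have hne : 2 < |(flow α 0 x).1.1| ∨ v 0 ≠ 0 := by
      rw [hr0, hv0]
      by_contra! h
      exact hcon ⟨h.1, by simpa [hp.ne'] using h.2⟩
    rcases le_total 0 ((flow α 0 x).1.1 * v 0) with h | h
    · exact hminus (hv.tendsto_abs_atTop hα hc hne h)
    -- An inward moving trajectory moves outwards after time reversal, so it escapes as `t → -∞`.
    · have h1 := hv.reverse.tendsto_abs_atTop hα hc (by simpa using hne) (by simpa using h)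
      refine hplus ?_
      simpa [Function.comp_def] using h1.comp tendsto_neg_atBot_atTop
  · rintro ⟨-, hr, hρ⟩
    have hconst : ∀ t, (flow α t x).1.1 = x.1.1 := fun t => by
      rw [← hr0]
      exact (hv.eq_const hα (s := 0) (by simpa [hr0] using hr) (by rw [hv0, hρ, zero_div]) t).1
    have hnot : ∀ l : Filter ℝ, l.NeBot → ¬ Tendsto (fun t => |(flow α t x).1.1|) l atTop := by
      intro l _ hl
      simp only [hconst] at hl
      exact not_tendsto_const_atTop _ _ hl
    exact ⟨⟨hx, hnot _ inferInstance⟩, hx, hnot _ inferInstance⟩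

end Revolution

/-! ### Averaging the transit time over slopes -/

namespace Revolution

/-- Under `u = c + 5ts²` the integrand times the Jacobian is the constant `10t`, and the window
becomes `0 < s < 24/t` because `5t(24/t)² = 2880/t`. -/
theorem lintegral_inv_sqrt_le (c : ℝ) {t : ℝ} (ht : 0 < t) :
    ∫⁻ u in Ioo c (c + 2880 / t), ENNReal.ofReal (Real.sqrt ((u - c) / (5 * t)))⁻¹ ≤ 240 := by
  have hd : ∀ s ∈ Ioo 0 (24 / t), HasDerivWithinAt (fun s : ℝ => c + 5 * t * s ^ 2)
      (10 * t * s) (Ioo 0 (24 / t)) s := fun s _ =>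
    ((((hasDerivAt_pow 2 s).const_mul (5 * t)).const_add c).congr_deriv
      (by norm_num; ring)).hasDerivWithinAt
  have hinj : InjOn (fun s : ℝ => c + 5 * t * s ^ 2) (Ioo 0 (24 / t)) := by
    intro s hs s' hs' e
    have e' : s ^ 2 = s' ^ 2 := by
      have h5 : 5 * t ≠ 0 := by positivity
      exact mul_left_cancel₀ h5 (add_left_cancel e)
    exact (sq_eq_sq₀ hs.1.le hs'.1.le).1 e'
  have hsub : Ioo c (c + 2880 / t) ⊆ (fun s : ℝ => c + 5 * t * s ^ 2) '' Ioo 0 (24 / t) := by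
    intro u hu
    have h1 : 0 < (u - c) / (5 * t) := div_pos (by linarith [hu.1]) (by positivity)
    refine ⟨Real.sqrt ((u - c) / (5 * t)), ⟨Real.sqrt_pos.2 h1, ?_⟩, ?_⟩
    · rw [Real.sqrt_lt' (by positivity), div_lt_iff₀ (by positivity)]
      have : (24 / t) ^ 2 * (5 * t) = 2880 / t := by field_simp; norm_num
      linarith [hu.2]
    · simp only [Real.sq_sqrt h1.le]
      field_simp
      ring
  refine (lintegral_mono_set hsub).trans ?_
  rw [lintegral_image_eq_lintegral_abs_deriv_mul measurableSet_Ioo hd hinj]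
  have hconst : ∀ s ∈ Ioo 0 (24 / t), ENNReal.ofReal |10 * t * s| *
      ENNReal.ofReal (Real.sqrt ((c + 5 * t * s ^ 2 - c) / (5 * t)))⁻¹
        = ENNReal.ofReal (10 * t) := by
    intro s hs
    have hs0 := hs.1
    rw [add_sub_cancel_left, mul_div_cancel_left₀ _ (by positivity), Real.sqrt_sq hs0.le,
      abs_of_pos (by positivity), ← ENNReal.ofReal_mul (by positivity)]
    congr 1
    field_simp
  rw [setLIntegral_congr_fun measurableSet_Ioo hconst, setLIntegral_const, Real.volume_Ioo,
    ← ENNReal.ofReal_mul (by positivity)]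
  rw [show 10 * t * (24 / t - 0) = 240 by field_simp; norm_num]
  simp

/-- The time density at a point where `α = A`, as a function of the slope `u = ρ / |η|` at a point
where `α⁻² = b`, has at most an inverse square root singularity. -/
theorem exists_inv_sqrt_bound {A b t : ℝ} (hA : 0 < A) (hb : 0 < b) (hb1 : b ≤ 1) (ht : 0 < t) :
    ∃ c : ℝ, ∀ u ∈ Ioc (1 / t) 2,
      (u ≤ c → (Real.sqrt (1 - (u ^ 2 + b)⁻¹ / A ^ 2))⁻¹ = 0) ∧
      (c < u → (Real.sqrt (1 - (u ^ 2 + b)⁻¹ / A ^ 2))⁻¹ ≤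
        (Real.sqrt ((u - c) / (5 * t)))⁻¹) := by
  set e := (A ^ 2)⁻¹ - b with he
  refine ⟨Real.sqrt e, fun u hu => ?_⟩
  have hu0 : 0 < u := lt_trans (by positivity) hu.1
  have hub : 0 < u ^ 2 + b := by positivity
  have hform : 1 - (u ^ 2 + b)⁻¹ / A ^ 2 = (u ^ 2 - e) / (u ^ 2 + b) := by
    rw [he]; field_simp; ring
  rw [hform]
  constructor
  · intro h
    have : u ^ 2 ≤ e := (Real.le_sqrt' hu0).1 h
    -- In the forbidden region the radicand is nonpositive, so the real square root and its inverse
    -- take the value `0` and contribute nothing.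
    rw [Real.sqrt_eq_zero_of_nonpos (div_nonpos_of_nonpos_of_nonneg (by linarith) hub.le), inv_zero]
  · intro h
    have hc0 := Real.sqrt_nonneg e
    have hce : e ≤ Real.sqrt e ^ 2 := by
      rcases le_total 0 e with h0 | h0
      · exact (Real.sq_sqrt h0).ge
      · exact h0.trans (sq_nonneg _)
    have h1 : 0 < (u - Real.sqrt e) / (5 * t) := div_pos (by linarith) (by positivity)
    refine inv_anti₀ (Real.sqrt_pos.2 h1) (Real.sqrt_le_sqrt ?_)
    rw [div_le_div_iff₀ (by positivity) hub]
    have h2 : u ^ 2 + b ≤ 5 := by nlinarith [hu.2]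
    -- The cutoff `u > 1/t` enters here: in `u² - e ≥ (u - √e) u` the factor `u` is at least `1/t`,
    -- which keeps the singularity of inverse square root type even when `e` is zero.
    have h3 : 1 ≤ t * u := by
      have := hu.1
      rw [div_lt_iff₀ ht] at this
      linarith
    calc (u - Real.sqrt e) * (u ^ 2 + b) ≤ (u - Real.sqrt e) * 5 := by gcongr
      _ ≤ (u - Real.sqrt e) * (5 * (t * u)) := by gcongr; linarith
      _ ≤ (u ^ 2 - e) * (5 * t) := by
        have : (u - Real.sqrt e) * u ≤ u ^ 2 - e := by nlinarith
        nlinarith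

/-- Within `2880/t` of the singularity integrate exactly; further away the density is at most
`t/24`. This value is small enough to be absorbed after multiplication by the length `6` of the
radial interval. -/
theorem lintegral_slope_le {A b t : ℝ} (hA : 0 < A) (hb : 0 < b) (hb1 : b ≤ 1) (ht : 0 < t)
    {G : Set ℝ} (hG : G ⊆ Ioc (1 / t) 2) (hGm : MeasurableSet G) :
    ∫⁻ u in G, ENNReal.ofReal (Real.sqrt (1 - (u ^ 2 + b)⁻¹ / A ^ 2))⁻¹ ≤
      240 + ENNReal.ofReal (t / 24) * volume G := by
  obtain ⟨c, hc⟩ := exists_inv_sqrt_bound hA hb hb1 ht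
  have hbd : ∀ u ∈ G, ENNReal.ofReal (Real.sqrt (1 - (u ^ 2 + b)⁻¹ / A ^ 2))⁻¹ ≤
      (Ioo c (c + 2880 / t)).indicator
        (fun u => ENNReal.ofReal (Real.sqrt ((u - c) / (5 * t)))⁻¹) u + ENNReal.ofReal (t / 24) := by
    intro u hu
    obtain ⟨h1, h2⟩ := hc u (hG hu)
    rcases le_or_gt u c with h | h
    · rw [h1 h]
      simp
    · rcases lt_or_ge u (c + 2880 / t) with h' | h'
      · rw [indicator_of_mem (show u ∈ Ioo c (c + 2880 / t) from ⟨h, h'⟩)]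
        exact le_add_right (ENNReal.ofReal_le_ofReal (h2 h))
      · refine le_add_left (ENNReal.ofReal_le_ofReal ((h2 h).trans ?_))
        rw [show t / 24 = (24 / t)⁻¹ by rw [inv_div]]
        refine inv_anti₀ (by positivity) (Real.le_sqrt_of_sq_le ?_)
        rw [le_div_iff₀ (by positivity)]
        have : (24 / t) ^ 2 * (5 * t) = 2880 / t := by field_simp; norm_num
        linarith
  refine (setLIntegral_mono' hGm hbd).trans ?_
  rw [lintegral_add_right _ measurable_const, setLIntegral_const]
  gcongr
  refine (setLIntegral_le_lintegral _ _).trans ?_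
  rw [lintegral_indicator measurableSet_Ioo]
  exact lintegral_inv_sqrt_le c ht

theorem measurable_transitTime {α : ℝ → ℝ} (hα : Continuous α) (b : ℝ) :
    Measurable fun u : ℝ => transitTime α (u ^ 2 + b)⁻¹ := by
  refine Measurable.lintegral_prod_right' (ν := volume.restrict (Icc (-3 : ℝ) 3))
    (f := fun p : ℝ × ℝ => ENNReal.ofReal (Real.sqrt (1 - (p.1 ^ 2 + b)⁻¹ / α p.2 ^ 2))⁻¹) ?_
  have := hα.measurable
  fun_prop

/-- The slopes `u ∈ (1/t, 2]` for which the transit time is at least `t / 2`. -/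
def slowSlopes (α : ℝ → ℝ) (b t : ℝ) : Set ℝ :=
  Ioc (1 / t) 2 ∩ {u | ENNReal.ofReal (t / 2) ≤ transitTime α (u ^ 2 + b)⁻¹}

theorem measurableSet_slowSlopes {α : ℝ → ℝ} (hα : Continuous α) (b t : ℝ) :
    MeasurableSet (slowSlopes α b t) :=
  measurableSet_Ioc.inter (measurableSet_le measurable_const (measurable_transitTime hα b))

/-- Markov's inequality for the transit time, with Tonelli to integrate first in the slope at fixed
radius. -/
theorem volume_slowSlopes_le {α : ℝ → ℝ} (hα : IsCylindricalProfile α) {b t : ℝ} (hb : 0 < b)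
    (hb1 : b ≤ 1) (ht : 0 < t) : volume (slowSlopes α b t) ≤ ENNReal.ofReal (5760 / t) := by
  set G := slowSlopes α b t with hGdef
  have hGm : MeasurableSet G := measurableSet_slowSlopes hα.smooth.continuous b t
  have hGsub : G ⊆ Ioc (1 / t) 2 := inter_subset_left
  have hfin : volume G ≠ ⊤ := ((measure_mono hGsub).trans_lt (by simp)).ne
  have hmarkov : ENNReal.ofReal (t / 2) * volume G ≤ ∫⁻ u in G, transitTime α (u ^ 2 + b)⁻¹ := by
    rw [← setLIntegral_const]
    exact setLIntegral_mono' hGm fun u hu => hu.2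
  have hswap : ∫⁻ u in G, transitTime α (u ^ 2 + b)⁻¹ =
      ∫⁻ y in Icc (-3 : ℝ) 3, ∫⁻ u in G,
        ENNReal.ofReal (Real.sqrt (1 - (u ^ 2 + b)⁻¹ / α y ^ 2))⁻¹ := by
    refine lintegral_lintegral_swap (Measurable.aemeasurable ?_)
    have := hα.smooth.continuous.measurable
    unfold Function.uncurry
    fun_prop
  have hle : ∫⁻ u in G, transitTime α (u ^ 2 + b)⁻¹ ≤
      (240 + ENNReal.ofReal (t / 24) * volume G) * 6 := by
    rw [hswap]
    refine (lintegral_mono fun y => lintegral_slope_le (hα.pos y) hb hb1 ht hGsub hGm).trans ?_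
    rw [setLIntegral_const, Real.volume_Icc]
    norm_num
  have h := hmarkov.trans hle
  rw [← ENNReal.ofReal_toReal hfin] at h ⊢
  set m := (volume G).toReal
  have hm : 0 ≤ m := ENNReal.toReal_nonneg
  rw [show (240 : ℝ≥0∞) = ENNReal.ofReal 240 by simp, show (6 : ℝ≥0∞) = ENNReal.ofReal 6 by simp,
    ← ENNReal.ofReal_mul (by positivity), ← ENNReal.ofReal_mul (by positivity),
    ← ENNReal.ofReal_add (by positivity) (by positivity), ← ENNReal.ofReal_mul (by positivity),
    ENNReal.ofReal_le_ofReal_iff (by positivity)] at h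
  refine ENNReal.ofReal_le_ofReal ?_
  -- Now `(t/2) m ≤ 1440 + (t/4) m`. Absorbing the last term is legitimate since `m` is finite.
  rw [le_div_iff₀ ht]
  linarith

end Revolution

/-! ### Estimates of the symplectic volume by slices -/

namespace Revolution

theorem volume_norm_mem_eq {F : Type*} [NormedAddCommGroup F] [InnerProductSpace ℝ F]
    [FiniteDimensional ℝ F] [MeasurableSpace F] [BorelSpace F] {n : ℕ}
    (hn : Module.finrank ℝ F = n) {S : Set ℝ} (hS : MeasurableSet S) :
    volume {η : F | ‖η‖ ∈ S} = volume {z : E n | ‖z‖ ∈ S} := by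
  subst hn
  have h := (stdOrthonormalBasis ℝ F).measurePreserving_repr.measure_preimage
    (s := {z | ‖z‖ ∈ S}) (measurable_norm hS).nullMeasurableSet
  rw [← h]
  simp [preimage]

theorem finrank_orthogonal_sphere {d : ℕ} (hd : 2 ≤ d) (θ : Metric.sphere (0 : E d) 1) :
    Module.finrank ℝ (ℝ ∙ (θ : E d))ᗮ = d - 1 := by
  have : Fact (Module.finrank ℝ (E d) = d - 1 + 1) := ⟨by simp; omega⟩
  exact Submodule.finrank_orthogonal_span_singleton (ne_zero_of_mem_unit_sphere θ)

/-- An upper bound for the symplectic volume of a set over `{|r| ≤ 3}`, in terms of its slices with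
fixed `r` and `‖η‖`. -/
theorem symplecticVolume_le {d : ℕ} (hd : 2 ≤ d) {A : ℝ} {N : ℝ → Set (ℝ × ℝ)} {m : ℝ≥0∞}
    (hN : ∀ r, MeasurableSet (N r))
    (hm : ∀ r, ∀ L ≤ A, volume {ρ | (ρ, L) ∈ N r} ≤ m) {S : Set (Phase d)}
    (hS : ∀ x ∈ S, |x.1.1| ≤ 3 ∧ ‖x.2.2‖ ≤ A ∧ (x.2.1, ‖x.2.2‖) ∈ N x.1.1) :
    symplecticVolume S ≤ m * volume {z : E (d - 1) | ‖z‖ ∈ Iic A} *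
      (volume : Measure (E d)).toSphere univ * 6 := by
  have hinner : ∀ r, ∀ θ : Metric.sphere (0 : E d) 1, ∫⁻ ρ : ℝ,
      (volume : Measure (ℝ ∙ (θ : E d))ᗮ) {η | ((r, (θ : E d)), (ρ, (η : E d))) ∈ S} ≤
        m * volume {z : E (d - 1) | ‖z‖ ∈ Iic A} := by
    intro r θ
    set T : Set (ℝ × (ℝ ∙ (θ : E d))ᗮ) := {q | ‖q.2‖ ∈ Iic A ∧ (q.1, ‖q.2‖) ∈ N r} with hT
    have hTm : MeasurableSet T := by
      refine MeasurableSet.inter ?_ ?_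
      · exact measurableSet_Iic.preimage (measurable_snd.norm)
      · exact (hN r).preimage (measurable_fst.prodMk measurable_snd.norm)
    -- No measurability of `S` is assumed, so its slice is first enlarged to the measurable `T`;
    -- only then is the order of `ρ` and `η` exchanged.
    calc ∫⁻ ρ : ℝ, (volume : Measure (ℝ ∙ (θ : E d))ᗮ) {η | ((r, (θ : E d)), (ρ, (η : E d))) ∈ S}
        ≤ ∫⁻ ρ : ℝ, (volume : Measure (ℝ ∙ (θ : E d))ᗮ) (Prod.mk ρ ⁻¹' T) :=
          lintegral_mono fun ρ => measure_mono fun η hη => (hS _ hη).2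
      _ = ((volume : Measure ℝ).prod (volume : Measure (ℝ ∙ (θ : E d))ᗮ)) T :=
          (Measure.prod_apply hTm).symm
      _ = ∫⁻ η : (ℝ ∙ (θ : E d))ᗮ, volume ((fun ρ : ℝ => (ρ, η)) ⁻¹' T) :=
          Measure.prod_apply_symm hTm
      _ ≤ ∫⁻ η : (ℝ ∙ (θ : E d))ᗮ, {η | ‖η‖ ∈ Iic A}.indicator (fun _ => m) η := by
          refine lintegral_mono fun η => ?_
          by_cases hη : ‖η‖ ≤ A
          · rw [indicator_of_mem (show η ∈ {η | ‖η‖ ∈ Iic A} from hη)]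
            exact (measure_mono fun ρ hρ => hρ.2).trans (hm r _ hη)
          · have : (fun ρ : ℝ => (ρ, η)) ⁻¹' T = ∅ :=
              eq_empty_of_forall_notMem fun ρ hρ => hη hρ.1
            rw [this]
            simp
      _ = m * volume {z : E (d - 1) | ‖z‖ ∈ Iic A} := by
          rw [lintegral_indicator_const (show MeasurableSet {η : (ℝ ∙ (θ : E d))ᗮ | ‖η‖ ∈ Iic A} from
              measurable_norm measurableSet_Iic),
            volume_norm_mem_eq (finrank_orthogonal_sphere hd θ) measurableSet_Iic]
  set M := m * volume {z : E (d - 1) | ‖z‖ ∈ Iic A}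
  have houter : ∀ r, ∫⁻ θ : Metric.sphere (0 : E d) 1, ∫⁻ ρ : ℝ,
      (volume : Measure (ℝ ∙ (θ : E d))ᗮ) {η | ((r, (θ : E d)), (ρ, (η : E d))) ∈ S}
        ∂volume ∂(volume : Measure (E d)).toSphere ≤
      (Icc (-3 : ℝ) 3).indicator (fun _ => M * (volume : Measure (E d)).toSphere univ) r := by
    intro r
    by_cases hr : r ∈ Icc (-3 : ℝ) 3
    · rw [indicator_of_mem hr, ← lintegral_const]
      exact lintegral_mono fun θ => hinner r θ
    · have hempty : ∀ (θ : Metric.sphere (0 : E d) 1) (ρ : ℝ),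
          {η : (ℝ ∙ (θ : E d))ᗮ | ((r, (θ : E d)), (ρ, (η : E d))) ∈ S} = ∅ := fun θ ρ =>
        eq_empty_of_forall_notMem fun η hη => hr (abs_le.1 (hS _ hη).1)
      simp [hempty]
  refine (lintegral_mono houter).trans ?_
  rw [lintegral_indicator_const measurableSet_Icc, Real.volume_Icc]
  norm_num

/-- A lower bound for the symplectic volume of a set that contains a box. -/
theorem le_symplecticVolume {d : ℕ} (hd : 2 ≤ d) {a b : ℝ} {S : Set (Phase d)} {I : Set ℝ}
    (hI : MeasurableSet I)
    (hS : ∀ r ∈ Icc (-b) b, ∀ θ η : E d, ‖θ‖ = 1 → ⟪θ, η⟫ = 0 → ∀ ρ ∈ Icc (-a) a, ‖η‖ ∈ I →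
      ((r, θ), (ρ, η)) ∈ S) :
    volume {z : E (d - 1) | ‖z‖ ∈ I} * ENNReal.ofReal (2 * a) *
      (volume : Measure (E d)).toSphere univ * ENNReal.ofReal (2 * b) ≤ symplecticVolume S := by
  have h2 : ∀ c : ℝ, volume (Icc (-c) c) = ENNReal.ofReal (2 * c) := fun c => by
    rw [Real.volume_Icc]; ring_nf
  rw [← h2 a, ← h2 b]
  have hinner : ∀ r ∈ Icc (-b) b, ∀ θ : Metric.sphere (0 : E d) 1,
      volume {z : E (d - 1) | ‖z‖ ∈ I} * volume (Icc (-a) a) ≤ ∫⁻ ρ : ℝ,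
      (volume : Measure (ℝ ∙ (θ : E d))ᗮ) {η | ((r, (θ : E d)), (ρ, (η : E d))) ∈ S} := by
    intro r hr θ
    rw [← setLIntegral_const]
    refine (setLIntegral_mono' measurableSet_Icc fun ρ hρ => ?_).trans (setLIntegral_le_lintegral _ _)
    rw [← volume_norm_mem_eq (finrank_orthogonal_sphere hd θ) hI]
    refine measure_mono fun η hη => hS r hr θ η (by simp) ?_ ρ hρ hη
    exact Submodule.mem_orthogonal_singleton_iff_inner_right.1 η.2
  rw [← setLIntegral_const]
  refine (setLIntegral_mono' measurableSet_Icc fun r hr => ?_).trans (setLIntegral_le_lintegral _ _)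
  rw [← lintegral_const]
  exact lintegral_mono fun θ => hinner r hr θ

theorem volume_norm_mem_ne_zero {n : ℕ} (hn : 1 ≤ n) {I : Set ℝ} (hI : IsOpen I)
    (hne : ∃ s ∈ I, 0 ≤ s) : volume {z : E n | ‖z‖ ∈ I} ≠ 0 := by
  obtain ⟨s, hs, hs0⟩ := hne
  refine ((hI.preimage continuous_norm).measure_pos volume
    ⟨EuclideanSpace.single ⟨0, hn⟩ s, ?_⟩).ne'
  simpa [abs_of_nonneg hs0] using hs

theorem volume_norm_mem_ne_top {n : ℕ} {I : Set ℝ} {A : ℝ} (hI : I ⊆ Iic A) :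
    volume {z : E n | ‖z‖ ∈ I} ≠ ⊤ := by
  refine ((measure_mono fun z hz => ?_).trans_lt
    (measure_closedBall_lt_top (μ := volume) (x := (0 : E n)) (r := A))).ne
  simpa using hI hz

end Revolution

/-! ### Two-sided bounds for the trapped volume -/

namespace Revolution

/-- The radial motion from the rescaling of a covector to unit length, with `u = ρ / ‖η‖`. -/
theorem exists_trajectory_rescaled {d : ℕ} (hd : 2 ≤ d) {α : ℝ → ℝ} (hα : IsCylindricalProfile α)
    {x : Phase d} (hx : x ∈ cotangent d) :
    (x.1, (symbol α x)⁻¹ • x.2) ∈ cosphere d α ∧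
      (∀ t, (flow α t (x.1, (symbol α x)⁻¹ • x.2)).1 ∈ mfd d) ∧
      ∃ v : ℝ → ℝ, IsTrajectory α (‖x.2.2‖ ^ 2 / symbol α x ^ 2)
          (fun t => (flow α t (x.1, (symbol α x)⁻¹ • x.2)).1.1) v ∧
        (flow α 0 (x.1, (symbol α x)⁻¹ • x.2)).1.1 = x.1.1 ∧ v 0 = x.2.1 / symbol α x := by
  have hp := symbol_pos (hα.pos _) hx
  have hpsq := symbol_sq α x
  set p := symbol α x
  have hy : (x.1, p⁻¹ • x.2) ∈ cotangent d := by
    refine ⟨hx.1, ?_, smul_ne_zero (inv_ne_zero hp.ne') hx.2.2⟩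
    show ⟪x.1.2, p⁻¹ • x.2.2⟫ = 0
    rw [inner_smul_right, show ⟪x.1.2, x.2.2⟫ = 0 from hx.2.1, mul_zero]
  have hnorm : ‖p⁻¹ • x.2.2‖ ^ 2 = ‖x.2.2‖ ^ 2 / p ^ 2 := by
    rw [norm_smul, Real.norm_of_nonneg (by positivity)]
    field_simp
  have hone : symbol α (x.1, p⁻¹ • x.2) = 1 := by
    refine (pow_eq_one_iff_of_nonneg (symbol_pos (hα.pos _) hy).le two_ne_zero).1 ?_
    rw [symbol_sq]
    show (p⁻¹ * x.2.1) ^ 2 + (α x.1.1)⁻¹ ^ 2 * ‖p⁻¹ • x.2.2‖ ^ 2 = 1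
    rw [hnorm]
    have : (p⁻¹ * x.2.1) ^ 2 + (α x.1.1)⁻¹ ^ 2 * (‖x.2.2‖ ^ 2 / p ^ 2) =
        (x.2.1 ^ 2 + (α x.1.1)⁻¹ ^ 2 * ‖x.2.2‖ ^ 2) / p ^ 2 := by ring
    rw [this, ← hpsq, div_self (by positivity)]
  obtain ⟨hcot, v, hv, h0, hv0⟩ := exists_trajectory_flow hd hα hy
  refine ⟨⟨hy, hone⟩, fun t => (hcot t).1, v, ?_, h0, ?_⟩
  · rw [hone, one_pow, div_one] at hv
    rw [← hnorm]
    exact hv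
  · rw [hv0, hone, div_one]
    show p⁻¹ * x.2.1 = _
    rw [div_eq_inv_mul]

/-- The slopes `ρ / ‖η‖` of the covectors that may be trapped for the time `t`. -/
def trappedSlopes (α : ℝ → ℝ) (b t : ℝ) : Set ℝ :=
  Icc (-(1 / t)) (1 / t) ∪ (slowSlopes α b t ∪ Neg.neg ⁻¹' slowSlopes α b t)

theorem measurableSet_trappedSlopes {α : ℝ → ℝ} (hα : Continuous α) (b t : ℝ) :
    MeasurableSet (trappedSlopes α b t) :=
  have h := measurableSet_slowSlopes hα b t
  measurableSet_Icc.union (h.union (measurable_neg h))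

theorem volume_trappedSlopes_le {α : ℝ → ℝ} (hα : IsCylindricalProfile α) {b t : ℝ} (hb : 0 < b)
    (hb1 : b ≤ 1) (ht : 0 < t) : volume (trappedSlopes α b t) ≤ ENNReal.ofReal (11522 / t) := by
  have h := volume_slowSlopes_le hα hb hb1 ht
  have hneg : volume (Neg.neg ⁻¹' slowSlopes α b t) = volume (slowSlopes α b t) :=
    Measure.measure_preimage_neg _ _
  calc volume (trappedSlopes α b t)
      ≤ volume (Icc (-(1 / t)) (1 / t)) +
        (volume (slowSlopes α b t) + volume (Neg.neg ⁻¹' slowSlopes α b t)) :=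
        (measure_union_le _ _).trans (by gcongr; exact measure_union_le _ _)
    _ ≤ ENNReal.ofReal (1 / t - -(1 / t)) +
        (ENNReal.ofReal (5760 / t) + ENNReal.ofReal (5760 / t)) := by
        rw [hneg, Real.volume_Icc]
        gcongr
    _ = ENNReal.ofReal (11522 / t) := by
        have h1 : (0 : ℝ) ≤ 1 / t := by positivity
        rw [← ENNReal.ofReal_add (by positivity) (by positivity),
          ← ENNReal.ofReal_add (by linarith) (by positivity)]
        congr 1
        ring

/-- The energy identity at time `0` gives `c = 1/(u² + b)`, and `c ≥ 1/4` forces `|u| ≤ 2`. If `|u|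
> 1/t` then `v 0 ≠ 0` and the transit time is at least `t/2`; the sign of `u` does not affect `c`.
-/
theorem slope_mem_trappedSlopes {α : ℝ → ℝ} (hα : IsCylindricalProfile α) {c : ℝ} {r v : ℝ → ℝ}
    (h : IsTrajectory α c r v) {t : ℝ} (h7 : 7 ≤ t) (h0 : |r 0| ≤ 3) (ht : |r t| ≤ 3) {u : ℝ}
    (hu : u ^ 2 * c = v 0 ^ 2) (hc0 : 0 ≤ c) : u ∈ trappedSlopes α ((α (r 0))⁻¹ ^ 2) t := by
  have hc := h.quarter_le hα hc0 h7 h0 ht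
  have hcpos : 0 < c := by linarith
  have hmul : (u ^ 2 + (α (r 0))⁻¹ ^ 2) * c = 1 := by
    rw [add_mul, hu, ← h.energy 0]
    ring
  have hcinv : (u ^ 2 + (α (r 0))⁻¹ ^ 2)⁻¹ = c := inv_eq_of_mul_eq_one_right hmul
  have hu2 : |u| ≤ 2 := by
    refine abs_le_of_sq_le_sq ?_ (by norm_num)
    nlinarith [sq_nonneg (α (r 0))⁻¹, sq_nonneg u]
  rcases le_or_gt |u| (1 / t) with hsmall | hlarge
  · exact Or.inl (abs_le.1 hsmall)
  have hu0 : u ≠ 0 := by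
    rintro rfl
    rw [abs_zero] at hlarge
    have : 0 < 1 / t := by positivity
    linarith
  have hv0 : v 0 ≠ 0 := by
    intro hv0
    rw [hv0] at hu
    have : 0 < u ^ 2 * c := by positivity
    norm_num at hu
    rcases hu with hu | hu
    · exact hu0 hu
    · linarith
  have hT := h.half_le_transitTime hα hc0 (by linarith) h0 ht hv0
  rw [← hcinv] at hT
  rcases le_total 0 u with hpos | hneg
  · rw [abs_of_nonneg hpos] at hlarge hu2
    exact Or.inr (Or.inl ⟨⟨hlarge, hu2⟩, hT⟩)
  · rw [abs_of_nonpos hneg] at hlarge hu2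
    refine Or.inr (Or.inr ⟨⟨hlarge, hu2⟩, ?_⟩)
    show ENNReal.ofReal (t / 2) ≤ transitTime α ((-u) ^ 2 + _)⁻¹
    rwa [neg_sq]

/-- At fixed `r` and `L = ‖η‖` the admissible `ρ` lie in `L` times the set of trapped slopes, of
length at most `11522 L/t`. Over the cone `p ≤ 1` one has `L ≤ α(r) ≤ A`. -/
theorem exists_trappedVolume_le {d : ℕ} (hd : 2 ≤ d) {α : ℝ → ℝ} (hα : IsCylindricalProfile α) :
    ∃ C : ℝ, 0 < C ∧ ∀ t : ℝ, 0 < t → trappedVolume d α t ≤ ENNReal.ofReal (C * t⁻¹) := by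
  obtain ⟨A, hA⟩ := (isCompact_Icc (a := (-3 : ℝ)) (b := 3)).exists_bound_of_continuousOn
    hα.smooth.continuous.continuousOn
  have hA' : ∀ r, |r| ≤ 3 → α r ≤ A := fun r hr => (le_abs_self _).trans (hA r (abs_le.1 hr))
  have hA1 : 1 ≤ A := (hα.one_le 0).trans (hA' 0 (by norm_num))
  set κ := volume {z : E (d - 1) | ‖z‖ ∈ Iic A}
  set σ := (volume : Measure (E d)).toSphere univ
  have hκ : κ ≠ ⊤ := volume_norm_mem_ne_top le_rfl
  have hσ : σ ≠ ⊤ := measure_ne_top _ _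
  have key : ∀ t : ℝ, 0 < t →
      trappedVolume d α t ≤ d * (ENNReal.ofReal (A * (11522 / t)) * κ * σ * 6) := by
    intro t ht
    rw [trappedVolume, liouville]
    gcongr
    have hcommon : ∀ x ∈ {x : Phase d | x ∈ cotangent d ∧ symbol α x ≤ 1 ∧
        (x.1, (symbol α x)⁻¹ • x.2) ∈ cosphere d α ∩ trappedFor α (region d) t},
        |x.1.1| ≤ 3 ∧ ‖x.2.2‖ ≤ A ∧ |x.2.1| ≤ 1 := by
      rintro x ⟨hx, hp1, -, -, hr, -⟩
      have hp := symbol_pos (hα.pos _) hx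
      have hpsq := symbol_sq α x
      have hp2 : symbol α x ^ 2 ≤ 1 := pow_le_one₀ hp.le hp1
      have hr3 : |x.1.1| ≤ 3 := hr.2
      have hαr := hα.pos x.1.1
      refine ⟨hr3, ?_, ?_⟩
      · refine le_trans ?_ (hA' _ hr3)
        have h1 : ((α x.1.1)⁻¹ * ‖x.2.2‖) ^ 2 ≤ 1 := by
          rw [mul_pow]
          nlinarith [sq_nonneg x.2.1]
        have h2 := (sq_le_one_iff₀ (by positivity)).1 h1
        rwa [inv_mul_le_iff₀ hαr, mul_one] at h2
      · refine abs_le_one_iff_mul_self_le_one.2 ?_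
        have : 0 ≤ (α x.1.1)⁻¹ ^ 2 * ‖x.2.2‖ ^ 2 := by positivity
        nlinarith
    rcases lt_or_ge t 7 with h7 | h7
    -- For `t < 7` the trivial bound `|ρ| ≤ 1` suffices, as `2 ≤ 11522/t`.
    · refine symplecticVolume_le hd (N := fun _ => Icc (-1 : ℝ) 1 ×ˢ univ)
        (fun _ => measurableSet_Icc.prod MeasurableSet.univ) (fun _ L _ => ?_) (fun x hx => ?_)
      · have : {ρ : ℝ | (ρ, L) ∈ Icc (-1 : ℝ) 1 ×ˢ (univ : Set ℝ)} = Icc (-1) 1 := by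
          ext; simp
        rw [this, Real.volume_Icc]
        refine ENNReal.ofReal_le_ofReal ?_
        have h1 : 2 ≤ 11522 / t := by rw [le_div_iff₀ ht]; linarith
        nlinarith
      · obtain ⟨h1, h2, h3⟩ := hcommon x hx
        exact ⟨h1, h2, abs_le.1 h3, mem_univ _⟩
    · refine symplecticVolume_le hd
        (N := fun r => {q | 0 < q.2 ∧ q.1 / q.2 ∈ trappedSlopes α ((α r)⁻¹ ^ 2) t})
        (fun r => ?_) (fun r L hL => ?_) (fun x hx => ?_)
      · exact (measurableSet_lt measurable_const measurable_snd).inter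
          ((measurable_fst.div measurable_snd)
            (measurableSet_trappedSlopes hα.smooth.continuous _ _))
      · rcases le_or_gt L 0 with hL0 | hL0
        · have : {ρ : ℝ | (ρ, L) ∈ {q : ℝ × ℝ | 0 < q.2 ∧
              q.1 / q.2 ∈ trappedSlopes α ((α r)⁻¹ ^ 2) t}} = ∅ :=
            eq_empty_of_forall_notMem fun ρ hρ => hL0.not_gt hρ.1
          rw [this]
          simp
        · have hb : (α r)⁻¹ ^ 2 ≤ 1 := pow_le_one₀ (inv_nonneg.2 (hα.pos r).le)
            (inv_le_one_of_one_le₀ (hα.one_le r))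
          have hb0 : 0 < (α r)⁻¹ ^ 2 := pow_pos (inv_pos.2 (hα.pos r)) 2
          have hle : {ρ : ℝ | (ρ, L) ∈ {q : ℝ × ℝ | 0 < q.2 ∧
              q.1 / q.2 ∈ trappedSlopes α ((α r)⁻¹ ^ 2) t}} ⊆
              (· * L⁻¹) ⁻¹' trappedSlopes α ((α r)⁻¹ ^ 2) t := fun ρ hρ => by
            simpa [div_eq_mul_inv] using hρ.2
          refine (measure_mono hle).trans ?_
          rw [Real.volume_preimage_mul_right (inv_ne_zero hL0.ne'), inv_inv, abs_of_pos hL0,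
            ENNReal.ofReal_mul (by linarith)]
          gcongr
          exact volume_trappedSlopes_le hα hb0 hb ht
      · obtain ⟨h1, h2, -⟩ := hcommon x hx
        obtain ⟨hx, hp1, -, -, -, hrt⟩ := hx
        obtain ⟨-, -, v, hv, h0, hv0⟩ := exists_trajectory_rescaled hd hα hx
        have hp := symbol_pos (hα.pos _) hx
        have hc0 : 0 ≤ ‖x.2.2‖ ^ 2 / symbol α x ^ 2 := by positivity
        -- Angular momentum bounded below excludes `‖η‖ = 0`, where the slope is meaningless.
        have hc := hv.quarter_le hα hc0 h7 (by rw [h0]; exact h1) hrt.2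
        have hL : 0 < ‖x.2.2‖ := by
          refine (norm_nonneg _).lt_of_ne fun hL => ?_
          rw [← hL] at hc
          norm_num at hc
        have := slope_mem_trappedSlopes hα hv h7 (by rw [h0]; exact h1) hrt.2
          (u := x.2.1 / ‖x.2.2‖) (by rw [hv0]; field_simp) hc0
        rw [h0] at this
        exact ⟨h1, h2, hL, this⟩
  set Q := (d * (κ * σ * 6)).toReal with hQ
  have hfin : (d * (κ * σ * 6) : ℝ≥0∞) ≠ ⊤ := by finiteness
  refine ⟨A * 11522 * Q + 1, by positivity, fun t ht => (key t ht).trans ?_⟩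
  have : (d * (ENNReal.ofReal (A * (11522 / t)) * κ * σ * 6) : ℝ≥0∞) =
      ENNReal.ofReal (A * (11522 / t)) * (d * (κ * σ * 6)) := by ring
  rw [this, ← ENNReal.ofReal_toReal hfin, ← hQ, ← ENNReal.ofReal_mul (by positivity)]
  refine ENNReal.ofReal_le_ofReal ?_
  have h1 : 0 < t⁻¹ := by positivity
  rw [div_eq_mul_inv]
  nlinarith

/-- On the box `|r| ≤ 1`, `|ρ| ≤ 1/(4t)`, `1/4 < ‖η‖ < 1/2` one has `1/4 ≤ p ≤ 1`. So the radial
speed is at most `1/t`, and up to time `t` the straight motion stays in `|r| ≤ 2`. -/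
theorem exists_le_trappedVolume {d : ℕ} (hd : 2 ≤ d) {α : ℝ → ℝ} (hα : IsCylindricalProfile α) :
    ∃ c : ℝ, 0 < c ∧ ∀ t : ℝ, 1 ≤ t → ENNReal.ofReal (c * t⁻¹) ≤ trappedVolume d α t := by
  set κ := volume {z : E (d - 1) | ‖z‖ ∈ Ioo (1 / 4 : ℝ) (1 / 2)}
  set σ := (volume : Measure (E d)).toSphere univ
  have hκ : κ ≠ ⊤ := volume_norm_mem_ne_top (A := 1 / 2) fun s hs => hs.2.le
  have hκ0 : κ ≠ 0 := volume_norm_mem_ne_zero (by omega) isOpen_Ioo ⟨3 / 8, by norm_num, by norm_num⟩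
  have hσ : σ ≠ ⊤ := measure_ne_top _ _
  have hσ0 : σ ≠ 0 := by
    have : Nonempty (Fin d) := ⟨⟨0, by omega⟩⟩
    exact Measure.measure_univ_ne_zero.2 (Measure.toSphere_ne_zero _)
  have hfin : (d * (κ * σ) : ℝ≥0∞) ≠ ⊤ := by finiteness
  have hne : (d * (κ * σ) : ℝ≥0∞) ≠ 0 :=
    mul_ne_zero (by simp; omega) (mul_ne_zero hκ0 hσ0)
  refine ⟨(d * (κ * σ)).toReal, ENNReal.toReal_pos hne hfin, fun t ht => ?_⟩
  have htpos : 0 < t := by linarith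
  rw [ENNReal.ofReal_mul ENNReal.toReal_nonneg, ENNReal.ofReal_toReal hfin, trappedVolume, liouville]
  have hbox : κ * ENNReal.ofReal (2 * (1 / (4 * t))) * σ * ENNReal.ofReal (2 * 1) ≤
      symplecticVolume {x : Phase d | x ∈ cotangent d ∧ symbol α x ≤ 1 ∧
        (x.1, (symbol α x)⁻¹ • x.2) ∈ cosphere d α ∩ trappedFor α (region d) t} := by
    refine le_symplecticVolume hd measurableSet_Ioo ?_
    intro r hr θ η hθ hη ρ hρ hL
    have hr1 : |r| ≤ 1 := abs_le.2 hr
    have hρ1 : |ρ| ≤ 1 / (4 * t) := abs_le.2 hρ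
    have hx : (((r, θ), (ρ, η)) : Phase d) ∈ cotangent d := by
      refine ⟨hθ, hη, fun h => ?_⟩
      have : η = 0 := congrArg Prod.snd h
      rw [this, norm_zero] at hL
      norm_num at hL
    obtain ⟨hy, hmfd, v, hv, h0, hv0⟩ := exists_trajectory_rescaled hd hα hx
    have hp := symbol_pos (hα.pos _) hx
    have hpsq := symbol_sq α ((r, θ), (ρ, η))
    set x : Phase d := ((r, θ), (ρ, η))
    have hpsq' : symbol α x ^ 2 = ρ ^ 2 + ‖η‖ ^ 2 := by
      rw [hpsq]
      simp only [x, hα.eq_one r (by linarith)]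
      ring
    have hp4 : 1 / 4 ≤ symbol α x := by
      refine (sq_le_sq₀ (by norm_num) hp.le).1 ?_
      nlinarith [hL.1, sq_nonneg ρ]
    have hρ4 : |ρ| ≤ 1 / 4 := hρ1.trans (one_div_le_one_div_of_le (by norm_num) (by linarith))
    have hp1 : symbol α x ≤ 1 := by
      refine (sq_le_sq₀ hp.le zero_le_one).1 ?_
      have := sq_le_sq.2 (show |ρ| ≤ |1 / 4| by rwa [abs_of_pos (by norm_num : (0 : ℝ) < 1 / 4)])
      nlinarith [hL.1, hL.2]
    have hvt : |v 0| * t ≤ 1 := by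
      rw [hv0, abs_div, abs_of_pos hp, div_mul_eq_mul_div, div_le_one hp]
      have : |ρ| * t ≤ 1 / (4 * t) * t := by gcongr
      have h4 : 1 / (4 * t) * t = 1 / 4 := by field_simp
      exact this.trans (h4.trans_le hp4)
    have hline : ∀ s ∈ Icc 0 t, |r + v 0 * s| ≤ 2 := by
      intro s hs
      have h1 : |v 0 * s| ≤ |v 0| * t := by
        rw [abs_mul, abs_of_nonneg hs.1]
        gcongr
        exact hs.2
      linarith [abs_add_le r (v 0 * s)]
    have hrt := (hv.eq_line hα htpos.le (by rw [h0]; exact hline)).1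
    simp only [h0] at hrt
    refine ⟨hx, hp1, hy, hy.1, ⟨hθ, show |r| ≤ 3 by linarith⟩, hmfd t, ?_⟩
    rw [hrt]
    exact (hline t ⟨htpos.le, le_rfl⟩).trans (by norm_num)
  calc (d * (κ * σ) : ℝ≥0∞) * ENNReal.ofReal t⁻¹
      = d * (κ * ENNReal.ofReal (2 * (1 / (4 * t))) * σ * ENNReal.ofReal (2 * 1)) := by
        have : t⁻¹ = 2 * (1 / (4 * t)) * (2 * 1) := by field_simp; norm_num
        rw [this, ENNReal.ofReal_mul (by positivity)]
        ring
    _ ≤ _ := by gcongr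

end Revolution

end

theorem mainTheorem4 (d : ℕ) (hd : 2 ≤ d) (α : ℝ → ℝ) (hα : Revolution.IsCylindricalProfile α) :
    Revolution.trappedSet d α =
        {x | x ∈ Revolution.cotangent d ∧ |x.1.1| ≤ 2 ∧ x.2.1 = 0} ∧
      (∃ C : ℝ, 0 < C ∧ ∀ t : ℝ, 1 ≤ t →
        ENNReal.ofReal (C⁻¹ * t⁻¹) ≤ Revolution.trappedVolume d α t ∧
          Revolution.trappedVolume d α t ≤ ENNReal.ofReal (C * t⁻¹)) ∧
      (∀ Λ : ℝ, 0 < Λ → ∀ β : ℝ, 0 ≤ β → ∀ ε : ℝ, 0 < ε → ε < 1 →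
        ∃ C : ℝ, 0 < C ∧ ∀ R : ℝ, 2 ≤ R →
          ENNReal.ofReal (R ^ (d - 1)) *
              min (Revolution.trappedVolume d α ((1 - ε) * (Real.log R / (2 * Λ))))
                (ENNReal.ofReal (Real.exp (2 * β * (Real.log R / (2 * Λ)))) *
                  Revolution.trappedVolume d α (2 * (1 - ε) * (Real.log R / (2 * Λ)))) ≤
            ENNReal.ofReal (C * R ^ (d - 1) / Real.log R)) := by
  obtain ⟨C, hC, hup⟩ := Revolution.exists_trappedVolume_le hd hα
  obtain ⟨c, hc, hlow⟩ := Revolution.exists_le_trappedVolume hd hα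
  refine ⟨Revolution.trappedSet_eq hd hα, ⟨max C c⁻¹, lt_max_of_lt_left hC, fun t ht => ⟨?_, ?_⟩⟩, ?_⟩
  · refine le_trans (ENNReal.ofReal_le_ofReal ?_) (hlow t ht)
    gcongr
    exact inv_le_of_inv_le₀ hc (le_max_right _ _)
  · refine (hup t (by linarith)).trans (ENNReal.ofReal_le_ofReal ?_)
    gcongr
    exact le_max_left _ _
  · intro Λ hΛ β _ ε _ hε
    have h1 : 0 < 1 - ε := by linarith
    refine ⟨C * (2 * Λ / (1 - ε)), by positivity, fun R hR => ?_⟩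
    have hlog : 0 < Real.log R := Real.log_pos (by linarith)
    -- The first entry of the minimum already suffices. The time may be less than `1` here, which is
    -- why the upper bound was proved for all `t > 0`.
    calc _ ≤ ENNReal.ofReal (R ^ (d - 1)) *
          ENNReal.ofReal (C * ((1 - ε) * (Real.log R / (2 * Λ)))⁻¹) := by
          gcongr
          exact (min_le_left _ _).trans (hup _ (by positivity))
      _ = _ := by
          rw [← ENNReal.ofReal_mul (by positivity)]
          congr 1
          field_simp
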